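/- **Setting.** The observables of the $n$-qubit stabilizer sub-theory are the Hermitian elements of the $n$-qubit Pauli group (tensor products of $n$ Pauli matrices times $\pm1,\pm i$); a joint measurement $M$ is a finite family of pairwise commuting observables. A record $R$ is a finite sequence of joint measurements with outcomes, each of nonzero Born probability given the previous ones; it describes the quantum state $\rho_R$ obtained by the projection postulate from the maximally mixed state. A simulation of the sub-theory consists of a set $\Lambda$ of internal states, a (discrete) probability distribution $\mu_R$ on $\Lambda$ for every record $R$, an outcome distribution $\xi_M(\cdot\,|\,\lambda)$ for every joint measurement $M$ and $\lambda\in\Lambda$, and an update distribution $\Gamma_{M=k}(\cdot\,|\,\lambda)$ on $\Lambda$ for every $M$, outcome $k$ and $\lambda$, such that $\lambda\in\mathrm{Supp}(\mu_R)$ and $\xi_M(k|\lambda)>0$ imply that the outcome $M=k$ has nonzero Born probability in $\rho_R$. For a state $\rho$ put $\mathrm{Supp}(\mu_\rho)=\bigcup_{R:\rho_R=\rho}\mathrm{Supp}(\mu_R)$. The simulation satisfies * *State Update* if, whenever the measurement $M$ with outcome $k$ takes $\rho$ to $\rho'$, $\Gamma_{M=k}$ maps every $\lambda\in\mathrm{Supp}(\mu_\rho)$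 with $\xi_M(k|\lambda)>0$ into $\mathrm{Supp}(\mu_{\rho'})$; * *SSD* if $\mathrm{Supp}(\mu_\rho)\cap\mathrm{Supp}(\mu_\sigma)=\emptyset$ whenever $\mathrm{Tr}(\rho\sigma)=0$. An observable $O$ is a *partitioning measurement* for a set $s$ of states if for each outcome $k$ either some state in $s$ cannot give the outcome $k$, or the post-measurement states of $s$ for $O=k$ include two orthogonal ones. **Theorem 3.** 1. Let $n\ge 2$ and let $s$ be a set of more than $5\cdot 3^{n-2}$ pure $n$-qubit stabilizer states. Then $\bigcap_{\psi\in s}\mathrm{Supp}(\mu_{\psi})=\emptyset$ in every simulation of the $n$-qubit stabilizer sub-theory that satisfies State Update and SSD. 2. Every set of at least $6$ pure two-qubit stabilizer states has a partitioning measurement $O\ne\pm I$ in the Pauli group. 3. The number of pure $n$-qubit stabilizer states is $|S_n|=2^n\prod_{j=1}^n(2^j+1)$. 4. Consequently, for $n\ge2$, every simulation satisfying State Update and SSD has at least $|S_n|/(5\cdot3^{n-2})$ internal states. If its internal states can be stored (injectively) in $b$ bits, then $b\ge\log_2\bigl(|S_n|/(5\cdot 3^{n-2})\bigr)$ and $b\ge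 n(n-1)/2$; moreover $\log_2\bigl(|S_n|/(5\cdot 3^{n-2})\bigr)\sim n(n-1)/2$ as $n\to\infty$. So the memory is at least quadratic in $n$. -/

import Mathlib

open scoped Matrix

namespace StabSim

noncomputable section

/-- Operators on the Hilbert space of `n` qubits, in the computational basis. -/
abbrev Op (n : ℕ) : Type := Matrix (Fin n → Fin 2) (Fin n → Fin 2) ℂ

/-- The Pauli matrices `I, X, Y, Z`. -/
def pauli : Fin 4 → Matrix (Fin 2) (Fin 2) ℂ :=
  ![1, !![0, 1; 1, 0], !![0, -Complex.I; Complex.I, 0], !![1, 0; 0, -1]]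

/-- The tensor product of the Pauli matrices `pauli (p 0), …, pauli (p (n-1))`. -/
def pauliString {n : ℕ} (p : Fin n → Fin 4) : Op n :=
  Matrix.of fun a b => ∏ i, pauli (p i) (a i) (b i)

/-- The `n`-qubit Pauli group: tensor products of Pauli matrices with a factor `±1, ±i`. -/
def pauliGroup (n : ℕ) : Set (Op n) :=
  {A | ∃ (c : ℂ) (p : Fin n → Fin 4), c ^ 4 = 1 ∧ A = c • pauliString p}

/-- The observables of the `n`-qubit stabilizer sub-theory: Hermitian elements of the Pauli
group. Their eigenvalues lie in `{1, -1}`. -/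
structure PauliObs (n : ℕ) where
  op : Op n
  mem_pauliGroup : op ∈ pauliGroup n
  isHermitian : op.IsHermitian

/-- The projector onto the eigenspace of `O` with eigenvalue `k = ±1`. -/
def PauliObs.proj {n : ℕ} (O : PauliObs n) (k : ℤˣ) : Op n :=
  (1 / 2 : ℂ) • (1 + (((k : ℤ) : ℂ)) • O.op)

/-- A joint measurement: finitely many pairwise commuting observables. -/
structure JointMeas (n : ℕ) where
  len : ℕ
  obs : Fin len → PauliObs n
  comm : ∀ i j, Commute (obs i).op (obs j).op

/-- A joint measurement together with an outcome for each of its observables. -/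
structure Event (n : ℕ) where
  meas : JointMeas n
  outcome : Fin meas.len → ℤˣ

/-- The projector onto the joint eigenspace belonging to the outcomes (the factors commute). -/
def Event.proj {n : ℕ} (E : Event n) : Op n :=
  (List.ofFn fun i => (E.meas.obs i).proj (E.outcome i)).prod

/-- The Born probability of the outcome with projector `Q` in the state `ρ`. -/
def born {n : ℕ} (Q ρ : Op n) : ℂ := (Q * ρ).trace

/-- The state after a projective measurement of `ρ` with an outcome of projector `Q`
(used only if the outcome has nonzero probability). -/
def post {n : ℕ} (Q ρ : Op n) : Op n := (Q * ρ * Q).trace⁻¹ • (Q * ρ * Q)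

/-- A record: the measurements performed so far with their outcomes, the latest one first. -/
abbrev Record (n : ℕ) : Type := List (Event n)

/-- The quantum state described by a record; the empty record describes the maximally
mixed state. -/
def recordState {n : ℕ} : Record n → Op n
  | [] => (1 / 2 ^ n : ℂ) • 1
  | E :: R => post E.proj (recordState R)

/-- A record is possible if each outcome had nonzero probability when it was recorded. -/
def Possible {n : ℕ} : Record n → Prop
  | [] => True
  | E :: R => Possible R ∧ born E.proj (recordState R) ≠ 0

/-- A classical simulation of the `n`-qubit stabilizer sub-theory with internal state space `Λ`:
the distribution `μ R` of the internal state given the record `R`, the distribution `ξ M l` of the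
outcomes of the joint measurement `M` in the internal state `l`, and the distribution `Γ E l` of the
new internal state when `M` is performed in the internal state `l` and gives the outcomes in `E`.
Of the Born rule only the following consequence is required: an internal state that can occur given
the record `R` never produces an outcome that is impossible given `R`. -/
structure Simulation (n : ℕ) (Λ : Type*) where
  μ : {R : Record n // Possible R} → PMF Λ
  ξ : (M : JointMeas n) → Λ → PMF (Fin M.len → ℤˣ)
  Γ : Event n → Λ → PMF Λ
  possible_of_mem : ∀ (R : {R : Record n // Possible R}) (E : Event n) (l : Λ),
    l ∈ (μ R).support → E.outcome ∈ (ξ E.meas l).support → born E.proj (recordState R.1) ≠ 0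

namespace Simulation

variable {n : ℕ} {Λ : Type*}

/-- `Supp(μ_ρ)`: the union of the supports of `μ R` over all records `R` that describe `ρ`. -/
def supp (S : Simulation n Λ) (ρ : Op n) : Set Λ :=
  {l | ∃ R : {R : Record n // Possible R}, recordState R.1 = ρ ∧ l ∈ (S.μ R).support}

/-- State update: if a measurement with given outcomes takes `ρ` to `ρ'`, then the update map takes
each internal state in `Supp(μ_ρ)` that can produce these outcomes into `Supp(μ_ρ')`. -/
def StateUpdate (S : Simulation n Λ) : Prop :=
  ∀ (ρ : Op n) (E : Event n) (l : Λ), born E.proj ρ ≠ 0 → l ∈ S.supp ρ →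
    E.outcome ∈ (S.ξ E.meas l).support → (S.Γ E l).support ⊆ S.supp (post E.proj ρ)

/-- Single-shot distinguishability: orthogonal states have disjoint supports. -/
def SSD (S : Simulation n Λ) : Prop :=
  ∀ ρ σ : Op n, (ρ * σ).trace = 0 → S.supp ρ ∩ S.supp σ = ∅

end Simulation

/-- A unit vector is a stabilizer vector if `2 ^ n` elements of the Pauli group fix it. -/
def IsStabVector {n : ℕ} (ψ : (Fin n → Fin 2) → ℂ) : Prop :=
  star ψ ⬝ᵥ ψ = 1 ∧ {A | A ∈ pauliGroup n ∧ A *ᵥ ψ = ψ}.ncard = 2 ^ n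

/-- The pure `n`-qubit stabilizer states `|ψ⟩⟨ψ|`. -/
def stabStates (n : ℕ) : Set (Op n) :=
  {ρ | ∃ ψ : (Fin n → Fin 2) → ℂ, IsStabVector ψ ∧ ρ = Matrix.vecMulVec ψ (star ψ)}

/-- `O` is a partitioning measurement for `s`: for every outcome, either two of the post-measurement
states are orthogonal, or the outcome is impossible (hence there is no post-measurement state) for
one of the states in `s`. -/
def IsPartitioning {n : ℕ} (O : PauliObs n) (s : Set (Op n)) : Prop :=
  ∀ k : ℤˣ, (∃ ρ ∈ s, born (O.proj k) ρ = 0) ∨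
    ∃ ρ ∈ s, ∃ σ ∈ s, (post (O.proj k) ρ * post (O.proj k) σ).trace = 0

/-- The number `2 ^ n * ∏_{j=1}^n (2 ^ j + 1)`. -/
def stabCount (n : ℕ) : ℕ := 2 ^ n * ∏ j ∈ Finset.Icc 1 n, (2 ^ j + 1)

end

end StabSim

namespace StabSim

noncomputable section

/-! Up to phase, Pauli strings are the vectors of `F₂^(2n)`, and the symplectic form records whether
two of them commute. A pure stabilizer state amounts to a Lagrangian subspace `L` together with
compatible signs on it (`mem_stabStates_iff`, `StabBy.ext`).

Suppose that one internal state lies in the supports of all states in `s`. Measuring a string `v` in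
it gives some outcome `κ v`, which is then possible for every state in `s`, and leads to an internal
state common to all post-measurement states; by SSD no two of these are orthogonal. This is the
condition `Consistent`. If `v` stabilizes one state of `s` and `w` another, and the two strings
commute, measuring `v + w` forces the signs `κ` to be multiplicative on them
(`Consistent.mul_of_mem`). A Mermin square with two stabilizing strings on each of its six lines is
therefore impossible (`Consistent.false_of_square`).

When all stabilizers contain a common `G` of dimension `n - 2`, they correspond to some of the 15
Lagrangian planes of the four-dimensional space `G^⊥ / G`. A finite check shows that any six planes
produce such a square, so `s` has at most five elements (`not_consistent_of_six`). With `n = 2` and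
`G = 0` the same argument gives the partitioning measurement.

For smaller `G` the bound is tripled at each missing dimension (`Simulation.encard_le_of_mem_supp`).
Take states with stabilizers `L₀ ≠ L₁`, a string `o₁` in `L₁` but not in `L₀`, and `o₀` in `L₀`
anticommuting with it; let `K = L₀ ∩ o₁^⊥`. Every Lagrangian subspace meets one of the three nonzero
classes of `K^⊥ / K`, represented by `o₀`, `o₁`, `o₀ + o₁` (`IsLagrangian.exists_mem_coset`). On the
states of one class, measuring `o₀` or `o₁` is injective, again because of a Mermin square
(`Consistent.eq_of_measSub_eq`), and the results share a stabilizer subspace that is larger by one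
dimension.

For the count, Lagrangian subspaces are counted through their ordered bases, and Pauli conjugation
shows that each carries `2 ^ n` pure states. Measuring its stabilizer prepares any such state, so
its support is nonempty; choosing an internal state for each pure state has fibres of size at most
`5 * 3 ^ (n - 2)`, which bounds the number of internal states from below. The logarithmic bounds are
elementary. -/

/-- Phase-free Pauli strings: one pair of bits per qubit, for the factors `X` and `Z`. -/
abbrev PauliVec (n : ℕ) : Type := Fin n → ZMod 2 × ZMod 2

/-- The index in `pauli` of the Pauli matrix with given `X` and `Z` bits. -/
def pauliIndex (a : ZMod 2 × ZMod 2) : Fin 4 := (![![0, 3], ![1, 2]] : Fin 2 → Fin 2 → Fin 4) a.1 a.2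

/-- The Hermitian Pauli string with given bits. -/
def strOp {n : ℕ} (v : PauliVec n) : Op n := pauliString fun i => pauliIndex (v i)

/-- The sign `(-1) ^ t`. -/
def bitSign (t : ZMod 2) : ℂ := (![1, -1] : Fin 2 → ℂ) t

/-- A sign as a complex number. -/
def unitSign (k : ℤˣ) : ℂ := ((k : ℤ) : ℂ)

/-- The symplectic product of two bit pairs. -/
def bitForm (a b : ZMod 2 × ZMod 2) : ZMod 2 := a.1 * b.2 + a.2 * b.1

theorem zmod_two_cases (t : ZMod 2) : t = 0 ∨ t = 1 := by
  revert t; decide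

@[simp] theorem bitSign_zero : bitSign 0 = 1 := rfl

@[simp] theorem bitSign_one : bitSign 1 = -1 := rfl

theorem bitSign_add (s t : ZMod 2) : bitSign (s + t) = bitSign s * bitSign t := by
  rcases zmod_two_cases s with rfl | rfl <;> rcases zmod_two_cases t with rfl | rfl <;>
    simp [show (1 : ZMod 2) + 1 = 0 from rfl]

theorem bitSign_sum {ι : Type*} (s : Finset ι) (f : ι → ZMod 2) :
    bitSign (∑ i ∈ s, f i) = ∏ i ∈ s, bitSign (f i) := by
  classical
  induction s using Finset.induction with
  | empty => simp
  | insert a s ha ih => rw [Finset.sum_insert ha, Finset.prod_insert ha, bitSign_add, ih]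

@[simp] theorem unitSign_one : unitSign 1 = 1 := by simp [unitSign]

@[simp] theorem unitSign_neg_one : unitSign (-1) = -1 := by simp [unitSign]

theorem unitSign_mul (k l : ℤˣ) : unitSign (k * l) = unitSign k * unitSign l := by
  simp [unitSign]

@[simp] theorem unitSign_mul_self (k : ℤˣ) : unitSign k * unitSign k = 1 := by
  rw [← unitSign_mul, Int.units_mul_self, unitSign_one]

theorem unitSign_ne_zero (k : ℤˣ) : unitSign k ≠ 0 := fun h => by
  simpa [h] using unitSign_mul_self k

@[simp] theorem star_unitSign (k : ℤˣ) : star (unitSign k) = unitSign k := by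
  simp [unitSign]

/-! ### Pauli matrices and their tensor products. -/

theorem pauliIndex_bijective : Function.Bijective pauliIndex := by
  unfold pauliIndex; decide

theorem pauli_mul_self (j : Fin 4) : pauli j * pauli j = 1 := by
  fin_cases j <;> ext a b <;> fin_cases a <;> fin_cases b <;>
    simp [pauli, Matrix.mul_apply, Fin.sum_univ_two]

theorem pauli_isHermitian (j : Fin 4) : (pauli j)ᴴ = pauli j := by
  fin_cases j <;> ext a b <;> fin_cases a <;> fin_cases b <;>
    simp [pauli, Matrix.conjTranspose_apply]

theorem pauli_mul (a b : ZMod 2 × ZMod 2) :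
    ∃ c : ℂ, c ^ 4 = 1 ∧
      pauli (pauliIndex a) * pauli (pauliIndex b) = c • pauli (pauliIndex (a + b)) := by
  -- `ZMod 2` reduces to `Fin 2`, where the sixteen cases can be enumerated.
  have key : ∀ (a b : Fin 2 × Fin 2), ∃ c : ℂ, c ^ 4 = 1 ∧
      pauli ((![![0, 3], ![1, 2]] : Fin 2 → Fin 2 → Fin 4) a.1 a.2) *
        pauli ((![![0, 3], ![1, 2]] : Fin 2 → Fin 2 → Fin 4) b.1 b.2) =
        c • pauli ((![![0, 3], ![1, 2]] : Fin 2 → Fin 2 → Fin 4) (a.1 + b.1) (a.2 + b.2)) := by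
    rintro ⟨a1, a2⟩ ⟨b1, b2⟩
    fin_cases a1 <;> fin_cases a2 <;> fin_cases b1 <;> fin_cases b2
    all_goals
      first
      | (refine ⟨1, by norm_num, ?_⟩
         ext a b; fin_cases a <;> fin_cases b <;>
          simp [pauli, Matrix.mul_apply, Fin.sum_univ_two] <;> done)
      | (refine ⟨Complex.I, by simp, ?_⟩
         ext a b; fin_cases a <;> fin_cases b <;>
          simp [pauli, Matrix.mul_apply, Fin.sum_univ_two] <;> done)
      | (refine ⟨-Complex.I, by rw [Even.neg_pow (by decide), Complex.I_pow_four], ?_⟩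
         ext a b; fin_cases a <;> fin_cases b <;>
          simp [pauli, Matrix.mul_apply, Fin.sum_univ_two])
  exact key a b

theorem pauli_mul_comm (a b : ZMod 2 × ZMod 2) :
    pauli (pauliIndex a) * pauli (pauliIndex b) =
      bitSign (bitForm a b) • (pauli (pauliIndex b) * pauli (pauliIndex a)) := by
  have key : ∀ (a b : Fin 2 × Fin 2),
      pauli ((![![0, 3], ![1, 2]] : Fin 2 → Fin 2 → Fin 4) a.1 a.2) *
        pauli ((![![0, 3], ![1, 2]] : Fin 2 → Fin 2 → Fin 4) b.1 b.2) =
      (![1, -1] : Fin 2 → ℂ) (a.1 * b.2 + a.2 * b.1) •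
      (pauli ((![![0, 3], ![1, 2]] : Fin 2 → Fin 2 → Fin 4) b.1 b.2) *
        pauli ((![![0, 3], ![1, 2]] : Fin 2 → Fin 2 → Fin 4) a.1 a.2)) := by
    rintro ⟨a1, a2⟩ ⟨b1, b2⟩
    fin_cases a1 <;> fin_cases a2 <;> fin_cases b1 <;> fin_cases b2 <;>
    ext a b <;> fin_cases a <;> fin_cases b <;>
      simp [pauli, Matrix.mul_apply, Fin.sum_univ_two]
  exact key a b

/-- Completeness of the Pauli matrices. -/
theorem sum_pauli (a b c d : Fin 2) :
    ∑ p : ZMod 2 × ZMod 2, pauli (pauliIndex p) a b * pauli (pauliIndex p) c d =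
      if a = d ∧ b = c then 2 else 0 := by
  rw [Function.Bijective.sum_comp pauliIndex_bijective
    (fun j => pauli j a b * pauli j c d), Fin.sum_univ_four]
  fin_cases a <;> fin_cases b <;> fin_cases c <;> fin_cases d <;>
    simp [pauli] <;> norm_num

variable {n : ℕ}

theorem pauliString_mul_apply (p q : Fin n → Fin 4) (a b : Fin n → Fin 2) :
    (pauliString p * pauliString q) a b = ∏ i, (pauli (p i) * pauli (q i)) (a i) (b i) := by
  simp only [Matrix.mul_apply, pauliString, Matrix.of_apply, Finset.prod_univ_sum,
    ← Finset.prod_mul_distrib, Fintype.piFinset_univ]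

theorem strOp_mul_self (v : PauliVec n) : strOp v * strOp v = 1 := by
  ext a b
  simp only [strOp, pauliString_mul_apply, pauli_mul_self, Matrix.one_apply]
  by_cases h : a = b
  · simp [h]
  · obtain ⟨i, hi⟩ := Function.ne_iff.1 h
    rw [if_neg h]
    exact Finset.prod_eq_zero (Finset.mem_univ i) (by simp [hi])

@[simp] theorem strOp_conjTranspose (v : PauliVec n) : (strOp v)ᴴ = strOp v := by
  ext a b
  simp only [strOp, Matrix.conjTranspose_apply, pauliString, Matrix.of_apply, star_prod]
  exact Finset.prod_congr rfl fun i _ => by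
    rw [← Matrix.conjTranspose_apply, pauli_isHermitian]

@[simp] theorem strOp_zero : strOp (0 : PauliVec n) = 1 := by
  ext a b
  have h0 : pauliIndex (0 : ZMod 2 × ZMod 2) = 0 := rfl
  simp only [strOp, pauliString, Matrix.of_apply, Pi.zero_apply, h0]
  rw [show pauli 0 = 1 from rfl]
  simp only [Matrix.one_apply]
  by_cases h : a = b
  · simp [h]
  · obtain ⟨i, hi⟩ := Function.ne_iff.1 h
    rw [if_neg h]
    exact Finset.prod_eq_zero (Finset.mem_univ i) (by simp [hi])

theorem exists_strOp_mul (v w : PauliVec n) :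
    ∃ c : ℂ, c ^ 4 = 1 ∧ strOp v * strOp w = c • strOp (v + w) := by
  choose c hc hcm using fun i => pauli_mul (v i) (w i)
  refine ⟨∏ i, c i, by rw [← Finset.prod_pow]; exact Finset.prod_eq_one fun i _ => hc i, ?_⟩
  ext a b
  rw [strOp, strOp, pauliString_mul_apply]
  simp only [hcm, Matrix.smul_apply, strOp, pauliString, Matrix.of_apply,
    Finset.prod_mul_distrib, smul_eq_mul, Pi.add_apply]

/-- The symplectic form, which tells whether two Pauli strings commute. -/
def sform (v w : PauliVec n) : ZMod 2 := ∑ i, bitForm (v i) (w i)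

theorem strOp_mul_comm (v w : PauliVec n) :
    strOp v * strOp w = bitSign (sform v w) • (strOp w * strOp v) := by
  ext a b
  rw [Matrix.smul_apply, strOp, strOp, pauliString_mul_apply, pauliString_mul_apply, sform,
    bitSign_sum, smul_eq_mul, ← Finset.prod_mul_distrib]
  exact Finset.prod_congr rfl fun i _ => by
    rw [pauli_mul_comm, Matrix.smul_apply, smul_eq_mul]

/-- The `n`-fold tensor power of `sum_pauli`. Averaging over the Pauli group and expansion in
strings both follow from it. -/
theorem sum_strOp (a b c d : Fin n → Fin 2) :
    ∑ v : PauliVec n, strOp v a b * strOp v c d = if a = d ∧ b = c then 2 ^ n else 0 := by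
  simp only [strOp, pauliString, Matrix.of_apply, ← Finset.prod_mul_distrib]
  have h := (Finset.prod_univ_sum (fun _ : Fin n => (Finset.univ : Finset (ZMod 2 × ZMod 2)))
    (fun i p => pauli (pauliIndex p) (a i) (b i) * pauli (pauliIndex p) (c i) (d i))).symm
  rw [Fintype.piFinset_univ] at h
  rw [h]
  simp only [sum_pauli]
  by_cases h : a = d ∧ b = c
  · obtain ⟨rfl, rfl⟩ := h
    simp
  · rw [if_neg h]
    have : ∃ i, ¬ (a i = d i ∧ b i = c i) := by
      by_contra! hc
      exact h ⟨funext fun i => (hc i).1, funext fun i => (hc i).2⟩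
    obtain ⟨i, hi⟩ := this
    exact Finset.prod_eq_zero (Finset.mem_univ i) (if_neg hi)

/-- Averaging over the Pauli group. -/
theorem sum_strOp_conj (M : Op n) :
    ∑ v : PauliVec n, strOp v * M * strOp v = (2 ^ n * M.trace) • (1 : Op n) := by
  ext a d
  simp only [Matrix.sum_apply, Matrix.mul_apply, Finset.sum_mul, Matrix.smul_apply,
    Matrix.one_apply, smul_eq_mul, Matrix.trace, Matrix.diag_apply]
  rw [Finset.sum_comm]
  simp_rw [Finset.sum_comm (s := (Finset.univ : Finset (PauliVec n)))]
  have : ∀ c b, ∑ v : PauliVec n, strOp v a b * M b c * strOp v c d =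
      (if a = d ∧ b = c then 2 ^ n else 0) * M b c := fun c b => by
    rw [← sum_strOp, Finset.sum_mul]
    exact Finset.sum_congr rfl fun v _ => by ring
  simp_rw [this]
  by_cases h : a = d
  · simp [h, Finset.mul_sum]
  · simp [h]

/-- The expansion of an operator in Pauli strings. -/
theorem eq_sum_strOp (M : Op n) :
    M = (1 / 2 ^ n : ℂ) • ∑ v : PauliVec n, (strOp v * M).trace • strOp v := by
  ext a d
  simp only [Matrix.sum_apply, Matrix.smul_apply, smul_eq_mul, Matrix.trace, Matrix.diag_apply,
    Matrix.mul_apply, Finset.sum_mul]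
  rw [Finset.sum_comm]
  simp_rw [Finset.sum_comm (s := (Finset.univ : Finset (PauliVec n)))]
  have : ∀ c b, ∑ v : PauliVec n, strOp v c b * M b c * strOp v a d =
      (if c = d ∧ b = a then 2 ^ n else 0) * M b c := fun c b => by
    rw [← sum_strOp, Finset.sum_mul]
    exact Finset.sum_congr rfl fun v _ => by ring
  simp_rw [this]
  have h2 : ∀ c b, (if c = d ∧ b = a then (2 ^ n : ℂ) else 0) * M b c =
      if c = d then (if b = a then 2 ^ n * M a d else 0) else 0 := fun c b => by
    by_cases h1 : c = d <;> by_cases h2 : b = a <;> simp [h1, h2]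
  simp [h2]

/-! ### The symplectic form over the field with two elements. -/

/-- The symplectic form as a bilinear form. -/
def sympl (n : ℕ) : LinearMap.BilinForm (ZMod 2) (PauliVec n) :=
  LinearMap.mk₂ (ZMod 2) sform
    (fun a b c => by
      simp only [sform, bitForm, ← Finset.sum_add_distrib, Pi.add_apply, Prod.fst_add, Prod.snd_add]
      exact Finset.sum_congr rfl fun i _ => by ring)
    (fun t a b => by
      simp only [sform, bitForm, Pi.smul_apply, Prod.smul_fst, Prod.smul_snd,
        smul_eq_mul, Finset.mul_sum]
      exact Finset.sum_congr rfl fun i _ => by ring)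
    (fun a b c => by
      simp only [sform, bitForm, ← Finset.sum_add_distrib, Pi.add_apply, Prod.fst_add, Prod.snd_add]
      exact Finset.sum_congr rfl fun i _ => by ring)
    (fun t a b => by
      simp only [sform, bitForm, Pi.smul_apply, Prod.smul_fst, Prod.smul_snd,
        smul_eq_mul, Finset.mul_sum]
      exact Finset.sum_congr rfl fun i _ => by ring)

theorem sympl_apply (v w : PauliVec n) : sympl n v w = sform v w := rfl

theorem sform_add_left (u v w : PauliVec n) : sform (u + v) w = sform u w + sform v w :=
  LinearMap.map_add₂ (sympl n) u v w

theorem sform_add_right (u v w : PauliVec n) : sform u (v + w) = sform u v + sform u w :=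
  map_add (sympl n u) v w

theorem sform_comm (v w : PauliVec n) : sform v w = sform w v :=
  Finset.sum_congr rfl fun i _ => by simp only [bitForm]; ring

@[simp] theorem sform_self (v : PauliVec n) : sform v v = 0 :=
  Finset.sum_eq_zero fun i _ => by
    simp only [bitForm]; rw [mul_comm (v i).2]; exact CharTwo.add_self_eq_zero _

@[simp] theorem sform_zero_left (v : PauliVec n) : sform 0 v = 0 := LinearMap.map_zero₂ (sympl n) v

@[simp] theorem sform_zero_right (v : PauliVec n) : sform v 0 = 0 := map_zero (sympl n v)

theorem sympl_isRefl : (sympl n).IsRefl := fun v w h => by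
  rw [sympl_apply, sform_comm]; exact h

theorem exists_sform_eq_one {v : PauliVec n} (hv : v ≠ 0) : ∃ w, sform v w = 1 := by
  obtain ⟨i, hi⟩ := Function.ne_iff.1 hv
  have key : ∀ a : ZMod 2 × ZMod 2, a ≠ 0 → ∃ b, bitForm a b = 1 := by
    unfold bitForm; decide
  obtain ⟨b, hb⟩ := key (v i) hi
  refine ⟨Pi.single i b, ?_⟩
  rw [sform, Finset.sum_eq_single i]
  · simpa using hb
  · intro j _ hj
    simp [bitForm, hj]
  · simp

theorem sympl_nondegenerate : (sympl n).Nondegenerate := by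
  refine (sympl_isRefl.nondegenerate_iff_separatingLeft).2 fun v hv => ?_
  by_contra h
  obtain ⟨w, hw⟩ := exists_sform_eq_one h
  rw [← sympl_apply, hv w] at hw
  exact zero_ne_one hw

theorem add_self_pauliVec (v : PauliVec n) : v + v = 0 := by
  funext i; exact Prod.ext (CharTwo.add_self_eq_zero _) (CharTwo.add_self_eq_zero _)

theorem finrank_pauliVec : Module.finrank (ZMod 2) (PauliVec n) = 2 * n := by
  rw [Module.finrank_pi_fintype]; simp [mul_comm]

/-- Conjugation by an anticommuting string negates `strOp v` but preserves the trace. -/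
theorem trace_strOp {v : PauliVec n} (hv : v ≠ 0) : (strOp v).trace = 0 := by
  obtain ⟨w, hw⟩ := exists_sform_eq_one hv
  have h : strOp v = - (strOp w * strOp v * strOp w) := by
    have := strOp_mul_comm v w
    rw [hw, bitSign_one, neg_smul, one_smul] at this
    rw [mul_assoc, this, mul_neg, neg_neg, ← mul_assoc, strOp_mul_self, one_mul]
  have h2 : (strOp v).trace = - (strOp v).trace := by
    conv_lhs => rw [h]
    rw [Matrix.trace_neg, Matrix.trace_mul_comm, ← mul_assoc, strOp_mul_self, one_mul]
  exact self_eq_neg.1 h2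

theorem exists_unitSign {c : ℂ} (h : c * c = 1) : ∃ k : ℤˣ, c = unitSign k := by
  rcases mul_self_eq_one_iff.1 h with h | h
  · exact ⟨1, by simp [h]⟩
  · exact ⟨-1, by simp [h]⟩

theorem unitSign_injective : Function.Injective unitSign := fun k l h => by
  simpa [unitSign, Units.ext_iff] using h

theorem units_eq_neg_of_ne {k l : ℤˣ} (h : k ≠ l) : k = -l := by
  rcases Int.units_eq_one_or k with rfl | rfl <;> rcases Int.units_eq_one_or l with rfl | rfl <;>
    simp_all

theorem unitSign_neg (k : ℤˣ) : unitSign (-k) = -unitSign k := by simp [unitSign]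

theorem strOp_commute {v w : PauliVec n} (h : sform v w = 0) : strOp v * strOp w = strOp w * strOp v := by
  rw [strOp_mul_comm, h, bitSign_zero, one_smul]

theorem strOp_anticommute {v w : PauliVec n} (h : sform v w = 1) :
    strOp v * strOp w = -(strOp w * strOp v) := by
  rw [strOp_mul_comm, h, bitSign_one, neg_smul, one_smul]

/-- Multiples of different Pauli strings are different. -/
theorem eq_of_smul_strOp {c d : ℂ} {v w : PauliVec n} (hc : c ≠ 0)
    (h : c • strOp v = d • strOp w) : v = w := by
  by_contra hvw
  obtain ⟨e, he, hm⟩ := exists_strOp_mul v w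
  have hne : v + w ≠ 0 := fun h0 => hvw (by
    rw [← add_zero v, ← add_self_pauliVec w, ← add_assoc, h0, zero_add])
  have h1 : (c • strOp v * strOp v).trace = (d • strOp w * strOp v).trace := by rw [h]
  rw [smul_mul_assoc, smul_mul_assoc, Matrix.trace_smul, Matrix.trace_smul,
    Matrix.trace_mul_comm (strOp w), hm, Matrix.trace_smul, trace_strOp hne, strOp_mul_self] at h1
  simp [hc, Matrix.trace_one] at h1

/-! ### Lagrangian subspaces -/

/-- A Lagrangian subspace: it is its own symplectic complement. -/
def IsLagrangian (L : Submodule (ZMod 2) (PauliVec n)) : Prop :=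
  ∀ v, v ∈ L ↔ ∀ w ∈ L, sform v w = 0

theorem mem_sympl_orthogonal {S : Submodule (ZMod 2) (PauliVec n)} {v : PauliVec n} :
    v ∈ (sympl n).orthogonal S ↔ ∀ w ∈ S, sform w v = 0 :=
  LinearMap.BilinForm.mem_orthogonal_iff

theorem isLagrangian_iff {L : Submodule (ZMod 2) (PauliVec n)} :
    IsLagrangian L ↔ (sympl n).orthogonal L = L := by
  rw [eq_comm, SetLike.ext_iff]
  simp only [mem_sympl_orthogonal, IsLagrangian]
  refine forall_congr' fun v => iff_congr Iff.rfl (forall₂_congr fun w _ => ?_)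
  rw [sform_comm]

/-- The double complement `S^⊥⊥ = S`, in the form used for membership proofs. -/
theorem mem_of_forall_orthogonal {S : Submodule (ZMod 2) (PauliVec n)} {v : PauliVec n}
    (h : ∀ w, (∀ s ∈ S, sform s w = 0) → sform w v = 0) : v ∈ S := by
  rw [← LinearMap.BilinForm.orthogonal_orthogonal (sympl_nondegenerate (n := n)) sympl_isRefl S,
    mem_sympl_orthogonal]
  exact fun w hw => h w (mem_sympl_orthogonal.1 hw)

theorem finrank_sympl_orthogonal (S : Submodule (ZMod 2) (PauliVec n)) :
    Module.finrank (ZMod 2) ((sympl n).orthogonal S) = 2 * n - Module.finrank (ZMod 2) S := by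
  rw [LinearMap.BilinForm.finrank_orthogonal sympl_nondegenerate, finrank_pauliVec]

theorem natCard_submodule (S : Submodule (ZMod 2) (PauliVec n)) :
    Nat.card S = 2 ^ Module.finrank (ZMod 2) S := by
  rw [Module.natCard_eq_pow_finrank (K := ZMod 2)]; simp

theorem IsLagrangian.finrank_eq {L : Submodule (ZMod 2) (PauliVec n)} (h : IsLagrangian L) :
    Module.finrank (ZMod 2) L = n := by
  have h1 := finrank_sympl_orthogonal L
  rw [isLagrangian_iff.1 h] at h1
  have := Submodule.finrank_le L
  rw [finrank_pauliVec] at this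
  omega

theorem IsLagrangian.natCard_eq {L : Submodule (ZMod 2) (PauliVec n)} (h : IsLagrangian L) :
    Nat.card L = 2 ^ n := by
  rw [natCard_submodule, h.finrank_eq]

theorem isLagrangian_of_finrank {L : Submodule (ZMod 2) (PauliVec n)}
    (hi : ∀ v ∈ L, ∀ w ∈ L, sform v w = 0) (hL : Module.finrank (ZMod 2) L = n) :
    IsLagrangian L := by
  rw [isLagrangian_iff]
  refine (Submodule.eq_of_le_of_finrank_le
    (fun v hv => mem_sympl_orthogonal.2 fun w hw => hi w hw v hv) ?_).symm
  rw [finrank_sympl_orthogonal, hL]; omega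

theorem isLagrangian_of_natCard {L : Submodule (ZMod 2) (PauliVec n)}
    (hi : ∀ v ∈ L, ∀ w ∈ L, sform v w = 0) (hL : Nat.card L = 2 ^ n) : IsLagrangian L :=
  isLagrangian_of_finrank hi (Nat.pow_right_injective le_rfl (by
    simpa only [natCard_submodule] using hL))

theorem IsLagrangian.sform_eq_zero {L : Submodule (ZMod 2) (PauliVec n)} (h : IsLagrangian L)
    {v w : PauliVec n} (hv : v ∈ L) (hw : w ∈ L) : sform v w = 0 := (h v).1 hv w hw

theorem IsLagrangian.eq_of_le {L M : Submodule (ZMod 2) (PauliVec n)} (hL : IsLagrangian L)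
    (hM : IsLagrangian M) (h : L ≤ M) : L = M :=
  le_antisymm h fun v hv => (hL v).2 fun _ hw => hM.sform_eq_zero hv (h hw)

/-- The stabilizer after measuring the string `v`. -/
def measSub (L : Submodule (ZMod 2) (PauliVec n)) (v : PauliVec n) :
    Submodule (ZMod 2) (PauliVec n) :=
  (L ⊓ LinearMap.ker (sympl n v)) ⊔ Submodule.span (ZMod 2) {v}

theorem mem_sup_span_iff {S : Submodule (ZMod 2) (PauliVec n)} {v w : PauliVec n} :
    w ∈ S ⊔ Submodule.span (ZMod 2) {v} ↔ ∃ l ∈ S, w = l ∨ w = l + v := by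
  constructor
  · intro h
    obtain ⟨l, hl, y, hy, rfl⟩ := Submodule.mem_sup.1 h
    obtain ⟨t, rfl⟩ := Submodule.mem_span_singleton.1 hy
    refine ⟨l, hl, ?_⟩
    rcases zmod_two_cases t with rfl | rfl <;> simp
  · rintro ⟨l, hl, rfl | rfl⟩
    · exact Submodule.mem_sup_left hl
    · exact Submodule.add_mem _ (Submodule.mem_sup_left hl)
        (Submodule.mem_sup_right (Submodule.mem_span_singleton_self v))

theorem mem_measSub {L : Submodule (ZMod 2) (PauliVec n)} {v w : PauliVec n} :
    w ∈ measSub L v ↔ ∃ l ∈ L, sform v l = 0 ∧ (w = l ∨ w = l + v) := by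
  rw [measSub, mem_sup_span_iff]
  simp only [Submodule.mem_inf, LinearMap.mem_ker, sympl_apply, and_assoc]

theorem self_mem_measSub (L : Submodule (ZMod 2) (PauliVec n)) (v : PauliVec n) :
    v ∈ measSub L v :=
  mem_measSub.2 ⟨0, L.zero_mem, by simp⟩

/-- Isotropy is immediate. For maximality, `(L + ⟨v⟩)^⊥ = L ∩ v^⊥` lies in `measSub L v`, so
anything orthogonal to the latter lies in `L + ⟨v⟩`, and it is orthogonal to `v`. -/
theorem IsLagrangian.measSub {L : Submodule (ZMod 2) (PauliVec n)} (hL : IsLagrangian L)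
    (v : PauliVec n) : IsLagrangian (measSub L v) := by
  intro w
  constructor
  · intro hw u hu
    obtain ⟨l, hl, hlv, h1⟩ := mem_measSub.1 hw
    obtain ⟨m, hm, hmv, h2⟩ := mem_measSub.1 hu
    have hlv' := (sform_comm l v).trans hlv
    rcases h1 with rfl | rfl <;> rcases h2 with rfl | rfl <;>
      simp [sform_add_left, sform_add_right, hL.sform_eq_zero hl hm, hlv', hmv]
  · intro hw
    have hwv : sform v w = 0 := by rw [sform_comm]; exact hw v (self_mem_measSub L v)
    have h1 : w ∈ L ⊔ Submodule.span (ZMod 2) {v} := mem_of_forall_orthogonal fun u hu => by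
      rw [sform_comm]
      refine hw u (mem_measSub.2 ⟨u, (hL u).2 fun l hl => ?_, ?_, Or.inl rfl⟩)
      · rw [sform_comm]; exact hu l (Submodule.mem_sup_left hl)
      · exact hu v (Submodule.mem_sup_right (Submodule.mem_span_singleton_self v))
    obtain ⟨l, hl, h⟩ := mem_sup_span_iff.1 h1
    refine mem_measSub.2 ⟨l, hl, ?_, h⟩
    rcases h with rfl | rfl
    · exact hwv
    · simpa [sform_add_right] using hwv

/-! ### Stabilized operators -/

theorem sign_unique {ρ A : Op n} (hρ : ρ ≠ 0) {k l : ℤˣ} (hk : A * ρ = unitSign k • ρ)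
    (hl : A * ρ = unitSign l • ρ) : k = l :=
  unitSign_injective (smul_left_injective ℂ hρ (hk.symm.trans hl))

/-- The phase in a product of strings is a fourth root of unity; a common nonzero eigenoperator
forces it to be a sign, the product of the three eigenvalues. -/
theorem exists_sign_add {ρ : Op n} (hρ : ρ ≠ 0) {v w : PauliVec n} {k l : ℤˣ}
    (hv : strOp v * ρ = unitSign k • ρ) (hw : strOp w * ρ = unitSign l • ρ) :
    ∃ m : ℤˣ, strOp (v + w) * ρ = unitSign m • ρ ∧
      strOp v * strOp w = unitSign (k * l * m) • strOp (v + w) := by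
  obtain ⟨c, hc, hm⟩ := exists_strOp_mul v w
  have hc0 : c ≠ 0 := by rintro rfl; norm_num at hc
  have h1 : c • (strOp (v + w) * ρ) = (unitSign k * unitSign l) • ρ := by
    rw [← smul_mul_assoc, ← hm, mul_assoc, hw, mul_smul_comm, hv, smul_smul, mul_comm]
  have h2 : strOp (v + w) * ρ = (c⁻¹ * (unitSign k * unitSign l)) • ρ := by
    rw [mul_smul, ← h1, smul_smul, inv_mul_cancel₀ hc0, one_smul]
  have h3 : ρ = ((c⁻¹ * (unitSign k * unitSign l)) * (c⁻¹ * (unitSign k * unitSign l))) • ρ := by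
    conv_lhs => rw [← one_mul ρ, ← strOp_mul_self (v + w), mul_assoc, h2, mul_smul_comm, h2,
      smul_smul]
  have h4 : (c⁻¹ * (unitSign k * unitSign l)) * (c⁻¹ * (unitSign k * unitSign l)) = 1 :=
    smul_left_injective ℂ hρ (by simpa using h3.symm)
  obtain ⟨m, hm'⟩ := exists_unitSign h4
  refine ⟨m, by rw [h2, hm'], ?_⟩
  have hcc : c⁻¹ * c⁻¹ = 1 := by
    linear_combination h4 - c⁻¹ * c⁻¹ * unitSign l * unitSign l * unitSign_mul_self k -
      c⁻¹ * c⁻¹ * unitSign_mul_self l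
  have hcc' : c = c⁻¹ := by
    calc c = c * (c⁻¹ * c⁻¹) := by rw [hcc, mul_one]
      _ = c⁻¹ := by rw [← mul_assoc, mul_inv_cancel₀ hc0, one_mul]
  have : c = unitSign (k * l * m) := by
    rw [unitSign_mul, unitSign_mul, ← hm']
    linear_combination hcc' - c⁻¹ * unitSign l * unitSign l * unitSign_mul_self k -
      c⁻¹ * unitSign_mul_self l
  rw [hm, this]

/-- The strings that stabilize a nonzero operator up to sign. -/
def stabSub (ρ : Op n) (hρ : ρ ≠ 0) : Submodule (ZMod 2) (PauliVec n) where
  carrier := {v | ∃ k : ℤˣ, strOp v * ρ = unitSign k • ρ}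
  zero_mem' := ⟨1, by simp⟩
  add_mem' := by
    rintro v w ⟨k, hk⟩ ⟨l, hl⟩
    obtain ⟨m, hm, -⟩ := exists_sign_add hρ hk hl
    exact ⟨m, hm⟩
  smul_mem' := by
    rintro t v ⟨k, hk⟩
    rcases zmod_two_cases t with rfl | rfl
    · exact ⟨1, by simp⟩
    · exact ⟨k, by simpa using hk⟩

theorem mem_stabSub {ρ : Op n} {hρ : ρ ≠ 0} {v : PauliVec n} :
    v ∈ stabSub ρ hρ ↔ ∃ k : ℤˣ, strOp v * ρ = unitSign k • ρ := Iff.rfl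

/-- Anticommuting strings would give `ρ = -ρ`. Hence stabilizers are isotropic. -/
theorem sform_eq_zero_of_sign {ρ : Op n} (hρ : ρ ≠ 0) {v w : PauliVec n} {k l : ℤˣ}
    (hv : strOp v * ρ = unitSign k • ρ) (hw : strOp w * ρ = unitSign l • ρ) : sform v w = 0 := by
  rcases zmod_two_cases (sform v w) with h | h
  · exact h
  · exfalso
    have h1 : strOp v * strOp w * ρ = (unitSign k * unitSign l) • ρ := by
      rw [mul_assoc, hw, mul_smul_comm, hv, smul_smul, mul_comm]
    have h2 : strOp w * strOp v * ρ = (unitSign k * unitSign l) • ρ := by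
      rw [mul_assoc, hv, mul_smul_comm, hw, smul_smul]
    rw [strOp_anticommute h, neg_mul, h2, neg_eq_iff_add_eq_zero, ← two_smul ℂ, smul_smul,
      smul_eq_zero] at h1
    rcases h1 with h1 | h1
    · simp [unitSign_ne_zero] at h1
    · exact hρ h1

/-- `ρ` is a state with stabilizer `L`. -/
structure StabBy (L : Submodule (ZMod 2) (PauliVec n)) (ρ : Op n) : Prop where
  lag : IsLagrangian L
  herm : ρᴴ = ρ
  trace_one : ρ.trace = 1
  sign : ∀ v ∈ L, ∃ k : ℤˣ, strOp v * ρ = unitSign k • ρ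

namespace StabBy

variable {L M : Submodule (ZMod 2) (PauliVec n)} {ρ σ : Op n}

theorem ne_zero (h : StabBy L ρ) : ρ ≠ 0 := fun h0 => by simpa [h0] using h.trace_one

theorem mem_iff (h : StabBy L ρ) {v : PauliVec n} :
    v ∈ L ↔ ∃ k : ℤˣ, strOp v * ρ = unitSign k • ρ := by
  refine ⟨h.sign v, fun ⟨k, hk⟩ => (h.lag v).2 fun w hw => ?_⟩
  obtain ⟨l, hl⟩ := h.sign w hw
  exact sform_eq_zero_of_sign h.ne_zero hk hl

theorem unique (h : StabBy L ρ) (h' : StabBy M ρ) : L = M := by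
  ext v; rw [h.mem_iff, h'.mem_iff]

theorem mul_right (h : StabBy L ρ) {v : PauliVec n} {k : ℤˣ} (hk : strOp v * ρ = unitSign k • ρ) :
    ρ * strOp v = unitSign k • ρ := by
  have := congrArg Matrix.conjTranspose hk
  rwa [Matrix.conjTranspose_mul, Matrix.conjTranspose_smul, h.herm, strOp_conjTranspose,
    star_unitSign] at this

/-- Some element of `L` anticommutes with `v`; conjugating by it negates `strOp v * ρ`. So the Pauli
expansion of `ρ` has terms in `L` only. -/
theorem trace_strOp_mul_eq_zero (h : StabBy L ρ) {v : PauliVec n} (hv : v ∉ L) :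
    (strOp v * ρ).trace = 0 := by
  have : ∃ w ∈ L, sform v w = 1 := by
    by_contra! hc
    exact hv ((h.lag v).2 fun w hw => (zmod_two_cases _).resolve_right (hc w hw))
  obtain ⟨w, hw, hvw⟩ := this
  obtain ⟨k, hk⟩ := h.sign w hw
  have h1 : (strOp v * ρ).trace = (strOp w * (strOp v * ρ) * strOp w).trace := by
    rw [Matrix.trace_mul_comm (strOp w * _), ← mul_assoc, strOp_mul_self, one_mul]
  have h2 : strOp w * (strOp v * ρ) * strOp w = -(strOp v * ρ) := by
    rw [mul_assoc, mul_assoc, h.mul_right hk, mul_smul_comm, mul_smul_comm, ← mul_assoc,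
      ← neg_eq_iff_eq_neg.2 (strOp_anticommute hvw), neg_mul, mul_assoc, hk, mul_smul_comm,
      smul_neg, smul_smul, unitSign_mul_self, one_smul]
  rw [h2, Matrix.trace_neg] at h1
  exact self_eq_neg.1 h1

/-- A state is determined by its stabilizer and the signs. -/
theorem ext (h : StabBy L ρ) (h' : StabBy L σ)
    (hs : ∀ v ∈ L, ∀ k : ℤˣ, strOp v * ρ = unitSign k • ρ → strOp v * σ = unitSign k • σ) :
    ρ = σ := by
  rw [eq_sum_strOp ρ, eq_sum_strOp σ]
  congr 1
  refine Finset.sum_congr rfl fun v _ => ?_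
  congr 1
  by_cases hv : v ∈ L
  · obtain ⟨k, hk⟩ := h.sign v hv
    rw [hk, hs v hv k hk, Matrix.trace_smul, Matrix.trace_smul, h.trace_one, h'.trace_one]
  · rw [h.trace_strOp_mul_eq_zero hv, h'.trace_strOp_mul_eq_zero hv]

end StabBy

theorem trace_mul_eq_zero_of_sign {ρ σ A : Op n} {k : ℤˣ} (hρ : ρ * A = unitSign k • ρ)
    (hσ : A * σ = unitSign (-k) • σ) : (ρ * σ).trace = 0 := by
  have h1 : ρ = unitSign k • (ρ * A) := by rw [hρ, smul_smul, unitSign_mul_self, one_smul]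
  have h2 : (ρ * σ).trace = -(ρ * σ).trace := by
    conv_lhs => rw [h1, smul_mul_assoc, mul_assoc, hσ, mul_smul_comm, smul_smul, unitSign_neg,
      mul_neg, unitSign_mul_self, neg_smul, one_smul, Matrix.trace_neg]
  exact self_eq_neg.1 h2

/-! ### Pure states -/

/-- Rank-one projectors. -/
def IsPure (ρ : Op n) : Prop :=
  ∃ ψ : (Fin n → Fin 2) → ℂ, star ψ ⬝ᵥ ψ = 1 ∧ ρ = Matrix.vecMulVec ψ (star ψ)

theorem IsPure.herm {ρ : Op n} (h : IsPure ρ) : ρᴴ = ρ := by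
  obtain ⟨ψ, -, rfl⟩ := h
  rw [Matrix.conjTranspose_vecMulVec, star_star]

theorem IsPure.trace_one {ρ : Op n} (h : IsPure ρ) : ρ.trace = 1 := by
  obtain ⟨ψ, h, rfl⟩ := h
  rw [Matrix.trace_vecMulVec, dotProduct_comm, h]

theorem vecMulVec_star_mulVec {ψ : (Fin n → Fin 2) → ℂ} (h : star ψ ⬝ᵥ ψ = 1) :
    Matrix.vecMulVec ψ (star ψ) *ᵥ ψ = ψ := by
  rw [Matrix.vecMulVec_mulVec, h]; simp

theorem mulVec_eq_iff {ψ : (Fin n → Fin 2) → ℂ} (h : star ψ ⬝ᵥ ψ = 1) (A : Op n) :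
    A *ᵥ ψ = ψ ↔ A * Matrix.vecMulVec ψ (star ψ) = Matrix.vecMulVec ψ (star ψ) := by
  constructor
  · intro hA
    rw [Matrix.mul_vecMulVec, hA]
  · intro hA
    have := congrArg (fun B => B *ᵥ ψ) hA
    simpa only [← Matrix.mulVec_mulVec, vecMulVec_star_mulVec h] using this

theorem exists_strOp_eq (p : Fin n → Fin 4) : ∃ v : PauliVec n, strOp v = pauliString p := by
  choose v hv using fun i => pauliIndex_bijective.2 (p i)
  exact ⟨v, by simp only [strOp, hv]⟩

theorem strOp_mem_pauliGroup (k : ℤˣ) (v : PauliVec n) : unitSign k • strOp v ∈ pauliGroup n :=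
  ⟨unitSign k, fun i => pauliIndex (v i), by
    rw [show (4 : ℕ) = 2 * 2 from rfl, pow_mul, pow_two (unitSign k), unitSign_mul_self, one_pow],
    rfl⟩

/-- Each string in `stabSub ρ hρ` fixes `ρ` with exactly one phase, which is `±1` because strings
square to the identity. -/
theorem ncard_stabilizer {ρ : Op n} (hρ : ρ ≠ 0) :
    {A | A ∈ pauliGroup n ∧ A * ρ = ρ}.ncard = Nat.card (stabSub ρ hρ) := by
  classical
  have hex : ∀ v : PauliVec n, ∃ k : ℤˣ, v ∈ stabSub ρ hρ → strOp v * ρ = unitSign k • ρ := by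
    intro v
    by_cases hv : v ∈ stabSub ρ hρ
    · obtain ⟨k, hk⟩ := mem_stabSub.1 hv
      exact ⟨k, fun _ => hk⟩
    · exact ⟨1, fun h => absurd h hv⟩
  choose e he using hex
  have himg : {A | A ∈ pauliGroup n ∧ A * ρ = ρ} =
      (fun v => unitSign (e v) • strOp v) '' (stabSub ρ hρ : Set (PauliVec n)) := by
    ext A
    constructor
    · rintro ⟨⟨c, p, hc, rfl⟩, hA⟩
      obtain ⟨v, hv⟩ := exists_strOp_eq p
      rw [← hv] at hA ⊢
      have hc0 : c ≠ 0 := by rintro rfl; norm_num at hc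
      have h1 : strOp v * ρ = c⁻¹ • ρ := by
        conv_rhs => rw [← hA, smul_mul_assoc, smul_smul, inv_mul_cancel₀ hc0, one_smul]
      have h2 : (c⁻¹ * c⁻¹) • ρ = ρ := by
        conv_rhs => rw [← one_mul ρ, ← strOp_mul_self v, mul_assoc, h1, mul_smul_comm, h1,
          smul_smul]
      have h3 : c⁻¹ * c⁻¹ = 1 := smul_left_injective ℂ hρ (by simpa using h2)
      obtain ⟨k, hk⟩ := exists_unitSign h3
      have hck : c = unitSign k := by
        rw [← hk]
        field_simp at h3 ⊢
        exact h3.symm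
      have hv' : strOp v * ρ = unitSign k • ρ := by rw [h1, hk]
      have hmem : v ∈ stabSub ρ hρ := ⟨k, hv'⟩
      exact ⟨v, hmem, by simp only [hck, sign_unique hρ (he v hmem) hv']⟩
    · rintro ⟨v, hv, rfl⟩
      refine ⟨strOp_mem_pauliGroup _ _, ?_⟩
      simp only [smul_mul_assoc]
      rw [he v hv, smul_smul, unitSign_mul_self, one_smul]
  rw [himg, Set.ncard_image_of_injective]
  · exact (Nat.card_coe_set_eq _).symm
  · intro v w h
    exact eq_of_smul_strOp (unitSign_ne_zero _) h

/-- The stabilizer is always isotropic; having `2 ^ n` elements is what makes it Lagrangian. -/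
theorem mem_stabStates_iff {ρ : Op n} :
    ρ ∈ stabStates n ↔ IsPure ρ ∧ ∃ L, StabBy L ρ := by
  constructor
  · rintro ⟨ψ, ⟨h1, hc⟩, rfl⟩
    have hp : IsPure (Matrix.vecMulVec ψ (star ψ)) := ⟨ψ, h1, rfl⟩
    have h0 : Matrix.vecMulVec ψ (star ψ) ≠ 0 := fun h0 => by simpa [h0] using hp.trace_one
    refine ⟨hp, stabSub _ h0, ?_, hp.herm, hp.trace_one, fun v hv => hv⟩
    refine isLagrangian_of_natCard ?_ ?_
    · rintro v ⟨k, hk⟩ w ⟨l, hl⟩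
      exact sform_eq_zero_of_sign h0 hk hl
    · rw [← ncard_stabilizer, ← hc]
      simp only [mulVec_eq_iff h1]
  · rintro ⟨⟨ψ, h1, rfl⟩, L, hL⟩
    refine ⟨ψ, ⟨h1, ?_⟩, rfl⟩
    simp only [mulVec_eq_iff h1]
    have : stabSub _ hL.ne_zero = L := by ext v; rw [hL.mem_iff, mem_stabSub]
    rw [ncard_stabilizer hL.ne_zero, this, hL.lag.natCard_eq]

/-! ### Measuring a Pauli string -/

theorem unitSign_smul_strOp_herm (k : ℤˣ) (v : PauliVec n) :
    (unitSign k • strOp v)ᴴ = unitSign k • strOp v := by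
  rw [Matrix.conjTranspose_smul, star_unitSign, strOp_conjTranspose]

/-- The observable of a Pauli string. -/
def strObs (v : PauliVec n) : PauliObs n where
  op := strOp v
  mem_pauliGroup := by simpa using strOp_mem_pauliGroup 1 v
  isHermitian := strOp_conjTranspose v

/-- The eigenprojector of a Pauli string. -/
def strProj (v : PauliVec n) (k : ℤˣ) : Op n := (strObs v).proj k

theorem strProj_eq (v : PauliVec n) (k : ℤˣ) :
    strProj v k = (1 / 2 : ℂ) • (1 + unitSign k • strOp v) := rfl

theorem strProj_conjTranspose (v : PauliVec n) (k : ℤˣ) : (strProj v k)ᴴ = strProj v k := by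
  rw [strProj_eq, Matrix.conjTranspose_smul, Matrix.conjTranspose_add, unitSign_smul_strOp_herm]
  simp

theorem strOp_mul_strProj (v : PauliVec n) (k : ℤˣ) :
    strOp v * strProj v k = unitSign k • strProj v k := by
  rw [strProj_eq, mul_smul_comm, mul_add, mul_one, mul_smul_comm, strOp_mul_self, smul_comm,
    smul_add (unitSign k), smul_smul (unitSign k), unitSign_mul_self, one_smul, add_comm]

theorem strProj_mul_of_sign {v : PauliVec n} {k : ℤˣ} {ρ : Op n}
    (h : strOp v * ρ = unitSign k • ρ) : strProj v k * ρ = ρ := by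
  rw [strProj_eq, smul_mul_assoc, add_mul, one_mul, smul_mul_assoc, h, smul_smul,
    unitSign_mul_self, one_smul, ← two_smul ℂ, smul_smul]
  norm_num

theorem strProj_mul_of_sign_neg {v : PauliVec n} {k : ℤˣ} {ρ : Op n}
    (h : strOp v * ρ = unitSign (-k) • ρ) : strProj v k * ρ = 0 := by
  rw [strProj_eq, smul_mul_assoc, add_mul, one_mul, smul_mul_assoc, h, smul_smul, unitSign_neg,
    mul_neg, unitSign_mul_self, neg_smul, one_smul, add_neg_cancel, smul_zero]

theorem strProj_mul_self (v : PauliVec n) (k : ℤˣ) : strProj v k * strProj v k = strProj v k :=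
  strProj_mul_of_sign (strOp_mul_strProj v k)

theorem strProj_commute {v w : PauliVec n} (h : sform v w = 0) (k : ℤˣ) :
    strOp w * strProj v k = strProj v k * strOp w := by
  rw [strProj_eq, mul_smul_comm, smul_mul_assoc, mul_add, add_mul, mul_smul_comm, smul_mul_assoc,
    mul_one, one_mul, strOp_commute h]

theorem trace_conj_eq_born {Q ρ : Op n} (hQ : Q * Q = Q) : (Q * ρ * Q).trace = born Q ρ := by
  rw [Matrix.trace_mul_comm, ← mul_assoc, hQ, born]

theorem trace_post {Q ρ : Op n} (hQ : Q * Q = Q) (h : born Q ρ ≠ 0) : (post Q ρ).trace = 1 := by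
  rw [post, Matrix.trace_smul, trace_conj_eq_born hQ, smul_eq_mul, inv_mul_cancel₀ h]

/-- The new vector is `Q *ᵥ ψ` divided by its norm, whose square is the Born probability. -/
theorem IsPure.post {Q ρ : Op n} (hρ : IsPure ρ) (hQ : Q * Q = Q) (hQ' : Qᴴ = Q)
    (h : born Q ρ ≠ 0) : IsPure (post Q ρ) := by
  obtain ⟨ψ, -, rfl⟩ := hρ
  have h1 : Q * Matrix.vecMulVec ψ (star ψ) * Q = Matrix.vecMulVec (Q *ᵥ ψ) (star (Q *ᵥ ψ)) := by
    rw [Matrix.mul_vecMulVec, Matrix.vecMulVec_mul, Matrix.star_mulVec, hQ']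
  set φ := Q *ᵥ ψ with hφ
  have h2 : (Q * Matrix.vecMulVec ψ (star ψ) * Q).trace = star φ ⬝ᵥ φ := by
    rw [h1, Matrix.trace_vecMulVec, dotProduct_comm]
  rw [← trace_conj_eq_born hQ, h2] at h
  obtain ⟨r, hr, hr'⟩ : ∃ r : ℝ, 0 < r ∧ star φ ⬝ᵥ φ = r := by
    have h3 : star φ ⬝ᵥ φ = ((∑ i, ‖φ i‖ ^ 2 : ℝ) : ℂ) := by
      simp only [dotProduct, Pi.star_apply, Complex.ofReal_sum]
      refine Finset.sum_congr rfl fun i _ => ?_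
      rw [mul_comm, Complex.star_def, Complex.mul_conj, Complex.normSq_eq_norm_sq]
    refine ⟨_, lt_of_le_of_ne (Finset.sum_nonneg fun i _ => by positivity) fun h0 => ?_, h3⟩
    rw [h3, ← h0] at h
    exact h Complex.ofReal_zero
  have hs : ((Real.sqrt r : ℝ) : ℂ) * ((Real.sqrt r : ℝ) : ℂ) = r := by
    rw [← Complex.ofReal_mul, Real.mul_self_sqrt hr.le]
  have hs0 : ((Real.sqrt r : ℝ) : ℂ) ≠ 0 := by
    rw [Ne, Complex.ofReal_eq_zero, Real.sqrt_eq_zero hr.le]; exact hr.ne'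
  have hst : star (((Real.sqrt r : ℝ) : ℂ)⁻¹) = ((Real.sqrt r : ℝ) : ℂ)⁻¹ := by
    rw [star_inv₀, Complex.star_def, Complex.conj_ofReal]
  refine ⟨((Real.sqrt r : ℝ) : ℂ)⁻¹ • φ, ?_, ?_⟩
  · rw [star_smul, hst, smul_dotProduct, dotProduct_smul, hr', smul_eq_mul, smul_eq_mul, ← hs]
    field_simp
  · rw [StabSim.post, h2, h1, hr', star_smul, hst, Matrix.smul_vecMulVec, Matrix.vecMulVec_smul,
      smul_smul, ← mul_inv, hs]

section Post

variable {L : Submodule (ZMod 2) (PauliVec n)} {ρ : Op n} {v w : PauliVec n} {k l : ℤˣ}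

theorem strOp_mul_post_self (v : PauliVec n) (k : ℤˣ) (ρ : Op n) :
    strOp v * post (strProj v k) ρ = unitSign k • post (strProj v k) ρ := by
  rw [post, mul_smul_comm, ← mul_assoc, ← mul_assoc, strOp_mul_strProj, smul_mul_assoc,
    smul_mul_assoc, smul_comm]

theorem strOp_mul_post_of_commute (hw : strOp w * ρ = unitSign l • ρ) (h : sform v w = 0) :
    strOp w * post (strProj v k) ρ = unitSign l • post (strProj v k) ρ := by
  rw [post, mul_smul_comm, ← mul_assoc, ← mul_assoc, strProj_commute h,
    mul_assoc (strProj v k) (strOp w) ρ,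
    hw, mul_smul_comm, smul_mul_assoc, smul_comm]

/-- Strings of `L` commuting with `v` keep their signs, and `v` acquires the sign of the outcome. -/
theorem StabBy.post (hL : StabBy L ρ) (h : born (strProj v k) ρ ≠ 0) :
    StabBy (measSub L v) (post (strProj v k) ρ) := by
  have htr := trace_post (strProj_mul_self v k) h
  have h0 : StabSim.post (strProj v k) ρ ≠ 0 := fun h0 => by simp [h0] at htr
  have hle : measSub L v ≤ stabSub _ h0 := by
    refine sup_le (fun w hw => ?_) ?_
    · obtain ⟨l, hl⟩ := hL.sign w hw.1
      exact ⟨l, strOp_mul_post_of_commute hl hw.2⟩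
    · rw [Submodule.span_singleton_le_iff_mem]
      exact ⟨k, strOp_mul_post_self v k ρ⟩
  refine ⟨hL.lag.measSub v, ?_, htr, fun w hw => hle hw⟩
  have h1 : (strProj v k * ρ * strProj v k)ᴴ = strProj v k * ρ * strProj v k := by
    rw [Matrix.conjTranspose_mul, Matrix.conjTranspose_mul, strProj_conjTranspose, hL.herm,
      mul_assoc]
  have h2 : star (strProj v k * ρ * strProj v k).trace = (strProj v k * ρ * strProj v k).trace := by
    rw [← Matrix.trace_conjTranspose, h1]
  rw [StabSim.post, Matrix.conjTranspose_smul, h1, star_inv₀, h2]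

theorem born_eq_zero_of_sign_neg (h : strOp v * ρ = unitSign (-k) • ρ) :
    born (strProj v k) ρ = 0 := by
  rw [born, strProj_mul_of_sign_neg h, Matrix.trace_zero]

theorem post_mem_stabStates (hρ : ρ ∈ stabStates n) (h : born (strProj v k) ρ ≠ 0) :
    post (strProj v k) ρ ∈ stabStates n := by
  obtain ⟨hp, L, hL⟩ := mem_stabStates_iff.1 hρ
  exact mem_stabStates_iff.2
    ⟨hp.post (strProj_mul_self v k) (strProj_conjTranspose v k) h, _, hL.post h⟩

end Post

/-! ### Consistent outcome assignments -/

/-- A choice of an outcome for each string that partitions none of them. -/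
def Consistent (s : Set (Op n)) (κ : PauliVec n → ℤˣ) : Prop :=
  ∀ v ≠ 0, (∀ ρ ∈ s, born (strProj v (κ v)) ρ ≠ 0) ∧
    ∀ ρ ∈ s, ∀ σ ∈ s, (post (strProj v (κ v)) ρ * post (strProj v (κ v)) σ).trace ≠ 0

/-- The strings that stabilize a state in `s` up to sign. -/
def stabUnion (s : Set (Op n)) : Set (PauliVec n) :=
  {v | ∃ ρ ∈ s, ∃ k : ℤˣ, strOp v * ρ = unitSign k • ρ}

theorem mem_stabUnion {s : Set (Op n)} {ρ : Op n} (hρ : ρ ∈ s)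
    {L : Submodule (ZMod 2) (PauliVec n)} (hL : StabBy L ρ) {v : PauliVec n} (hv : v ∈ L) :
    v ∈ stabUnion s :=
  ⟨ρ, hρ, hL.sign v hv⟩

/-- The string with its assigned sign. -/
def signedOp (κ : PauliVec n → ℤˣ) (v : PauliVec n) : Op n := unitSign (κ v) • strOp v

theorem signedOp_mul_self (κ : PauliVec n → ℤˣ) (v : PauliVec n) :
    signedOp κ v * signedOp κ v = 1 := by
  rw [signedOp, smul_mul_assoc, mul_smul_comm, strOp_mul_self, smul_smul, unitSign_mul_self,
    one_smul]

theorem signedOp_mul_comm (κ : PauliVec n → ℤˣ) {v w : PauliVec n} (h : sform v w = 0) :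
    signedOp κ v * signedOp κ w = signedOp κ w * signedOp κ v := by
  simp only [signedOp, smul_mul_assoc, mul_smul_comm, strOp_commute h]
  rw [smul_comm]

theorem signedOp_mul_anticomm (κ : PauliVec n → ℤˣ) {v w : PauliVec n} (h : sform v w = 1) :
    signedOp κ v * signedOp κ w = -(signedOp κ w * signedOp κ v) := by
  simp only [signedOp, smul_mul_assoc, mul_smul_comm, strOp_anticommute h, smul_neg]
  rw [smul_comm]

theorem add_add_cancel_pauliVec (v w : PauliVec n) : v + (v + w) = w := by
  rw [← add_assoc, add_self_pauliVec, zero_add]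

namespace Consistent

variable {s : Set (Op n)} {κ : PauliVec n → ℤˣ}

/-- With the opposite sign, the outcome `κ v` would have probability zero in `ρ`. -/
theorem sign_eq (hκ : Consistent s κ) {ρ : Op n} (hρ : ρ ∈ s) {v : PauliVec n} (hv : v ≠ 0)
    {k : ℤˣ} (hk : strOp v * ρ = unitSign k • ρ) : k = κ v := by
  by_contra h
  rw [units_eq_neg_of_ne h] at hk
  exact (hκ v hv).1 ρ hρ (born_eq_zero_of_sign_neg hk)

/-- Measure `v + w` on a state stabilized by `v` and on one stabilized by `w`. The first keeps the
sign of `v`, so its new state has a sign on `w` dictated by `κ v` and `κ (v + w)`; the second keeps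
`κ w`. Different signs on `w` would make the two new states orthogonal. -/
theorem mul_of_mem (hs : s ⊆ stabStates n) (hκ : Consistent s κ) {v w : PauliVec n}
    (hv : v ∈ stabUnion s) (hw : w ∈ stabUnion s) (hv0 : v ≠ 0) (hw0 : w ≠ 0)
    (hvw0 : v + w ≠ 0) (hvw : sform v w = 0) :
    signedOp κ v * signedOp κ w = signedOp κ (v + w) := by
  obtain ⟨ρ, hρ, k, hk⟩ := hv
  obtain ⟨σ, hσ, l, hl⟩ := hw
  obtain rfl := hκ.sign_eq hρ hv0 hk
  obtain rfl := hκ.sign_eq hσ hw0 hl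
  obtain ⟨hb, ho⟩ := hκ _ hvw0
  obtain ⟨-, L, hL⟩ := mem_stabStates_iff.1 (hs hρ)
  have hL' := hL.post (hb ρ hρ)
  have h1 : sform (v + w) v = 0 := by rw [sform_add_left, sform_self, sform_comm w, hvw, add_zero]
  have h2 : sform (v + w) w = 0 := by rw [sform_add_left, sform_self, hvw, add_zero]
  obtain ⟨m, hm, hm'⟩ := exists_sign_add hL'.ne_zero (strOp_mul_post_of_commute hk h1)
    (strOp_mul_post_self (v + w) (κ (v + w)) ρ)
  rw [add_add_cancel_pauliVec] at hm hm'
  have hmw : m = κ w := by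
    by_contra h
    refine ho ρ hρ σ hσ (trace_mul_eq_zero_of_sign (hL'.mul_right hm) ?_)
    have : κ w = -m := by rw [units_eq_neg_of_ne h, neg_neg]
    rw [← this]
    exact strOp_mul_post_of_commute hl h2
  have h3 : strOp (v + w) = unitSign (κ v * κ (v + w) * m) • (strOp v * strOp w) := by
    rw [← one_mul (strOp (v + w)), ← strOp_mul_self v, mul_assoc, hm', mul_smul_comm]
  rw [signedOp, signedOp, signedOp, h3, smul_mul_assoc, mul_smul_comm, smul_smul, smul_smul,
    ← unitSign_mul, ← unitSign_mul, hmw]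
  congr 2
  rw [mul_comm (κ v) (κ (v + w)), mul_assoc, ← mul_assoc (κ (v + w)), Int.units_mul_self, one_mul]

end Consistent

/-! ### Mermin squares. -/

/-- At least two of `v`, `w`, `v + w` belong to `T`. -/
def TwoMem (T : Set (PauliVec n)) (v w : PauliVec n) : Prop :=
  (v ∈ T ∧ w ∈ T) ∨ (v ∈ T ∧ v + w ∈ T) ∨ (w ∈ T ∧ v + w ∈ T)

namespace Consistent

variable {s : Set (Op n)} {κ : PauliVec n → ℤˣ}

/-- The signed strings are commuting involutions, so the relation on a line follows from any two of
its points. -/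
theorem mul_of_twoMem (hs : s ⊆ stabStates n) (hκ : Consistent s κ) {v w : PauliVec n}
    (h : TwoMem (stabUnion s) v w) (hv0 : v ≠ 0) (hw0 : w ≠ 0)
    (hvw0 : v + w ≠ 0) (hvw : sform v w = 0) :
    signedOp κ v * signedOp κ w = signedOp κ (v + w) := by
  rcases h with ⟨hv, hw⟩ | ⟨hv, hu⟩ | ⟨hw, hu⟩
  · exact hκ.mul_of_mem hs hv hw hv0 hw0 hvw0 hvw
  · have h1 := hκ.mul_of_mem hs hv hu hv0 hvw0 (by rwa [add_add_cancel_pauliVec])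
      (by rw [sform_add_right, sform_self, hvw, add_zero])
    rw [add_add_cancel_pauliVec] at h1
    rw [← h1, ← mul_assoc, signedOp_mul_self, one_mul]
  · have hwu : w + (v + w) = v := by rw [add_comm v, add_add_cancel_pauliVec]
    have h1 := hκ.mul_of_mem hs hw hu hw0 hvw0 (by rwa [hwu])
      (by rw [sform_add_right, sform_self, sform_comm, hvw, add_zero])
    rw [hwu] at h1
    rw [← h1, mul_assoc, signedOp_mul_comm κ (v := v + w) (w := w)
      (by rw [sform_add_left, sform_self, hvw, add_zero]), ← mul_assoc, signedOp_mul_self, one_mul]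

/-- A Mermin square has no consistent signs. -/
theorem false_of_square (hs : s ⊆ stabStates n) (hκ : Consistent s κ) {a b c d : PauliVec n}
    (hab : sform a b = 0) (hac : sform a c = 0) (hdb : sform d b = 0) (hdc : sform d c = 0)
    (had : sform a d = 1) (hbc : sform b c = 1)
    (r1 : TwoMem (stabUnion s) a b) (r2 : TwoMem (stabUnion s) c d)
    (r3 : TwoMem (stabUnion s) (a + c) (b + d)) (c1 : TwoMem (stabUnion s) a c)
    (c2 : TwoMem (stabUnion s) b d) (c3 : TwoMem (stabUnion s) (a + b) (c + d)) : False := by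
  have ne : ∀ {v w : PauliVec n}, sform v w = 1 → v ≠ 0 := fun h h0 => by simp [h0] at h
  have hbd := (sform_comm b d).trans hdb
  have hcd := (sform_comm c d).trans hdc
  have hda := (sform_comm d a).trans had
  have hcb := (sform_comm c b).trans hbc
  have hba := (sform_comm b a).trans hab
  have hca := (sform_comm c a).trans hac
  have e1 := hκ.mul_of_twoMem hs r1 (ne had) (ne hbc)
    (ne (w := c) (by simp [sform_add_left, *])) hab
  have e2 := hκ.mul_of_twoMem hs r2 (ne hcb) (ne hda)
    (ne (w := a) (by simp [sform_add_left, *])) hcd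
  have e3 := hκ.mul_of_twoMem hs r3 (ne (w := b) (by simp [sform_add_left, *]))
    (ne (w := a) (by simp [sform_add_left, *])) (ne (w := a) (by simp [sform_add_left, *]))
    (by simp [sform_add_left, sform_add_right, *, CharTwo.add_self_eq_zero])
  have f1 := hκ.mul_of_twoMem hs c1 (ne had) (ne hcb)
    (ne (w := b) (by simp [sform_add_left, *])) hac
  have f2 := hκ.mul_of_twoMem hs c2 (ne hbc) (ne hda)
    (ne (w := a) (by simp [sform_add_left, *])) hbd
  have f3 := hκ.mul_of_twoMem hs c3 (ne (w := c) (by simp [sform_add_left, *]))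
    (ne (w := a) (by simp [sform_add_left, *])) (ne (w := a) (by simp [sform_add_left, *]))
    (by simp [sform_add_left, sform_add_right, *, CharTwo.add_self_eq_zero])
  -- The ninth entry, computed along the last column and along the last row, gives `ab·cd = ac·bd`;
  -- cancelling `a` and `d` leaves `bc = cb`.
  rw [← e1, ← e2, show a + b + (c + d) = a + c + (b + d) by abel, ← e3, ← f1, ← f2] at f3
  have h1 : signedOp κ b * signedOp κ c = signedOp κ c * signedOp κ b := by
    have := congrArg (fun X => signedOp κ a * X * signedOp κ d) f3
    simp only [mul_assoc, signedOp_mul_self, mul_one] at this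
    simpa only [← mul_assoc, signedOp_mul_self, one_mul] using this
  rw [signedOp_mul_anticomm κ hbc, neg_eq_iff_add_eq_zero, ← two_smul ℂ, smul_eq_zero] at h1
  have h2 := h1.resolve_left two_ne_zero
  have h3 := signedOp_mul_self κ c
  have h4 : signedOp κ c * (signedOp κ c * signedOp κ b) * signedOp κ b = 1 := by
    rw [← mul_assoc, h3, one_mul, signedOp_mul_self]
  rw [h2, mul_zero, zero_mul] at h4
  exact zero_ne_one h4

/-- Measuring `o` does not merge the stabilizers of consistent states that contain suitable strings
anticommuting with `o`. -/
theorem eq_of_measSub_eq (hs : s ⊆ stabStates n) (hκ : Consistent s κ) {ρ σ : Op n} (hρ : ρ ∈ s)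
    (hσ : σ ∈ s) {L M : Submodule (ZMod 2) (PauliVec n)} (hL : StabBy L ρ) (hM : StabBy M σ)
    {o p q : PauliVec n} (ho : o ∈ stabUnion s) (hp : p ∈ L) (hq : q ∈ M)
    (hop : sform o p = 1) (hoq : sform o q = 1) (hpq : sform p q = 0) (hr : p + q ∈ stabUnion s)
    (h : measSub L o = measSub M o) : L = M := by
  have hpo := (sform_comm p o).trans hop
  have hqo := (sform_comm q o).trans hoq
  have hqp := (sform_comm q p).trans hpq
  -- If `x` is not in `M`, then `x + o` is, and the rows `x, x + o, o` and `p, q, p + q` span a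
  -- Mermin square whose first two columns lie in `L` and `M`.
  have key : ∀ x ∈ L, sform o x = 0 → x ∈ M := by
    intro x hx hox
    by_contra hxM
    have h1 : x ∈ measSub M o := h ▸ mem_measSub.2 ⟨x, hx, hox, Or.inl rfl⟩
    obtain ⟨y, hy, hoy, rfl | hxy⟩ := mem_measSub.1 h1
    · exact hxM hy
    have hy' : y = x + o := by rw [hxy, add_assoc, add_self_pauliVec, add_zero]
    rw [hy'] at hy
    have hxp := hL.lag.sform_eq_zero hx hp
    have hxo := (sform_comm x o).trans hox
    have hxq : sform x q = 1 := by
      have := hM.lag.sform_eq_zero hy hq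
      rw [sform_add_left, hoq] at this
      rcases zmod_two_cases (sform x q) with h | h
      · simp [h] at this
      · exact h
    refine hκ.false_of_square hs (a := x) (b := x + o) (c := p) (d := q) ?_ hxp ?_ hqp hxq ?_
      (Or.inl ⟨mem_stabUnion hρ hL hx, mem_stabUnion hσ hM hy⟩)
      (Or.inl ⟨mem_stabUnion hρ hL hp, mem_stabUnion hσ hM hq⟩)
      (Or.inl ⟨mem_stabUnion hρ hL (L.add_mem hx hp), mem_stabUnion hσ hM (M.add_mem hy hq)⟩)
      (Or.inl ⟨mem_stabUnion hρ hL hx, mem_stabUnion hρ hL hp⟩)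
      (Or.inl ⟨mem_stabUnion hσ hM hy, mem_stabUnion hσ hM hq⟩)
      (Or.inl ⟨by rwa [add_add_cancel_pauliVec], hr⟩)
    · simp [sform_add_right, hxo]
    · exact hM.lag.sform_eq_zero hq hy
    · simp [sform_add_left, hxp, hop]
  refine hL.lag.eq_of_le hM.lag fun x hx => ?_
  rcases zmod_two_cases (sform o x) with hox | hox
  · exact key x hx hox
  -- `M` is spanned by `M ∩ o^⊥` and `q`, and `p` commutes with both; then `x = (x + p) + p` with `x
  -- + p` commuting with `o`.
  · have hpM : p ∈ M := by
      refine (hM.lag p).2 fun y hy => ?_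
      have key' : ∀ y ∈ M, sform o y = 0 → sform p y = 0 := by
        intro y hy hoy
        have h1 : y ∈ measSub L o := h ▸ mem_measSub.2 ⟨y, hy, hoy, Or.inl rfl⟩
        obtain ⟨z, hz, hoz, rfl | hyz⟩ := mem_measSub.1 h1
        · exact hL.lag.sform_eq_zero hp hz
        · have hzM := key z hz hoz
          have : o ∈ M := by
            have := M.add_mem hzM hy
            rwa [hyz, add_add_cancel_pauliVec] at this
          rw [hM.lag.sform_eq_zero this hq] at hoq
          exact absurd hoq zero_ne_one
      rcases zmod_two_cases (sform o y) with hoy | hoy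
      · exact key' y hy hoy
      · have := key' (y + q) (M.add_mem hy hq) (by
          rw [sform_add_right, hoy, hoq]; exact CharTwo.add_self_eq_zero _)
        rwa [sform_add_right, hpq, add_zero] at this
    have := M.add_mem (key (x + p) (L.add_mem hx hp) (by
      rw [sform_add_right, hox, hop]; exact CharTwo.add_self_eq_zero _)) hpM
    rwa [add_assoc, add_self_pauliVec, add_zero] at this

end Consistent

/-! ### Lines and squares of a two-qubit system

The strings of two qubits are coded by the numbers below `16`, with addition the bitwise `xor`. -/

/-- The symplectic form on codes. -/
def codeForm (u v : ℕ) : Bool :=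
  ((u.testBit 0 && v.testBit 1) ^^ (u.testBit 1 && v.testBit 0)) ^^
    ((u.testBit 2 && v.testBit 3) ^^ (u.testBit 3 && v.testBit 2))

/-- Generators of the Lagrangian subspaces. -/
def codeLines : List (ℕ × ℕ) :=
  [(1, 4), (1, 8), (1, 12), (2, 4), (2, 8), (2, 12), (3, 4), (3, 8), (3, 12), (5, 10), (5, 11),
    (6, 9), (6, 11), (7, 9), (7, 10)]

/-- The top left corners of the Mermin squares. -/
def codeSquares : List ((ℕ × ℕ) × (ℕ × ℕ)) :=
  [((1, 4), (8, 2)), ((1, 4), (8, 3)), ((1, 4), (12, 2)), ((1, 4), (12, 3)), ((1, 8), (12, 2)),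
    ((1, 8), (12, 3)), ((2, 4), (8, 3)), ((2, 4), (12, 3)), ((2, 8), (12, 3)), ((5, 10), (11, 13))]

/-- The nonzero codes in a Lagrangian subspace, as a bit set. -/
def lineBits (l : ℕ × ℕ) : ℕ := 2 ^ l.1 ||| 2 ^ l.2 ||| 2 ^ (l.1 ^^^ l.2)

/-- At least two of `a`, `b` and their sum lie in the bit set `T`. -/
def twoBits (T a b : ℕ) : Bool :=
  (T.testBit a && T.testBit b) || (T.testBit a && T.testBit (a ^^^ b)) ||
    (T.testBit b && T.testBit (a ^^^ b))

/-- Each line of some Mermin square has at least two points in the bit set `T`. -/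
def hasSquare (T : ℕ) : Bool :=
  codeSquares.any fun q =>
    twoBits T q.1.1 q.1.2 && twoBits T q.2.1 q.2.2 &&
      twoBits T (q.1.1 ^^^ q.2.1) (q.1.2 ^^^ q.2.2) && twoBits T q.1.1 q.2.1 &&
      twoBits T q.1.2 q.2.2 && twoBits T (q.1.1 ^^^ q.1.2) (q.2.1 ^^^ q.2.2)

/-- Adding any `k` of the given lines to the bit set `T` produces a square. -/
def alwaysSquare : List (ℕ × ℕ) → ℕ → ℕ → Bool
  -- If `k ≠ 0` here, fewer lines were left than had to be chosen, so the branch is vacuously true.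
  | [], k, T => k != 0 || hasSquare T
  | l :: ls, k, T =>
    hasSquare T || (k != 0 && (alwaysSquare ls (k - 1) (T ||| lineBits l) && alwaysSquare ls k T))

/-- The combinatorial core: any six of the 15 planes cover two points on every line of one of the
ten squares. -/
theorem alwaysSquare_codeLines : alwaysSquare codeLines 6 0 = true := by
  decide +kernel

-- Soundness of the search: follow the branch that takes a line exactly when all its points satisfy
-- `B`. The set `T` then stays inside `B`, and enough such lines remain to make all `k` choices.
open Classical in
theorem exists_hasSquare (B : ℕ → Prop) (ls : List (ℕ × ℕ)) (k T : ℕ)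
    (h : alwaysSquare ls k T = true) (hT : ∀ c, T.testBit c = true → B c)
    (hk : k ≤ (ls.filter fun l => ∀ c, (lineBits l).testBit c = true → B c).length) :
    ∃ T', hasSquare T' = true ∧ ∀ c, T'.testBit c = true → B c := by
  induction ls generalizing k T with
  | nil =>
    obtain rfl : k = 0 := by simpa using hk
    exact ⟨T, by simpa [alwaysSquare] using h, hT⟩
  | cons l ls ih =>
    rw [alwaysSquare, Bool.or_eq_true, Bool.and_eq_true, Bool.and_eq_true] at h
    rcases h with h | ⟨-, h1, h2⟩
    · exact ⟨T, h, hT⟩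
    · by_cases hl : ∀ c, (lineBits l).testBit c = true → B c
      · refine ih (k - 1) _ h1 (fun c hc => ?_) ?_
        · rw [Nat.testBit_or, Bool.or_eq_true] at hc
          exact hc.elim (hT c) (hl c)
        · rw [List.filter_cons_of_pos (by simpa using hl), List.length_cons] at hk
          omega
      · refine ih k T h2 hT ?_
        rwa [List.filter_cons_of_neg (by simpa using hl)] at hk

/-- Completeness of the list of planes; the listed generators may be any two of the three nonzero
points. -/
theorem exists_codeLine : ∀ u v : Fin 16, u ≠ 0 → v ≠ 0 → u ≠ v → codeForm u v = false →
    ∃ l ∈ codeLines, (l.1 = u ∨ l.1 = v ∨ l.1 = u.val ^^^ v.val) ∧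
      (l.2 = u ∨ l.2 = v ∨ l.2 = u.val ^^^ v.val) := by
  decide +kernel

theorem mem_codeLine : ∀ l ∈ codeLines, ∀ c < 16, codeForm c l.1 = false → codeForm c l.2 = false →
    c = 0 ∨ c = l.1 ∨ c = l.2 ∨ c = l.1 ^^^ l.2 := by
  decide +kernel

theorem codeSquare_form : ∀ q ∈ codeSquares,
    codeForm q.1.1 q.1.2 = false ∧ codeForm q.1.1 q.2.1 = false ∧ codeForm q.2.2 q.1.2 = false ∧
      codeForm q.2.2 q.2.1 = false ∧ codeForm q.1.1 q.2.2 = true ∧ codeForm q.1.2 q.2.1 = true := by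
  decide +kernel

theorem nodup_codeLines : codeLines.Nodup := by decide +kernel

/-! ### Symplectic frames and the reduction to two qubits. -/

/-- Two orthogonal hyperbolic pairs that complement `G` in its symplectic complement. -/
structure IsFrame (G : Submodule (ZMod 2) (PauliVec n)) (f : Fin 4 → PauliVec n) : Prop where
  orth : ∀ i, ∀ g ∈ G, sform g (f i) = 0
  form : ∀ i j, sform (f i) (f j) =
    (![![0, 1, 0, 0], ![1, 0, 0, 0], ![0, 0, 0, 1], ![0, 0, 1, 0]] : Fin 4 → Fin 4 → ZMod 2) i j

/-- A bit as a scalar. -/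
def bitVal (b : Bool) : ZMod 2 := if b then 1 else 0

theorem sform_smul_left (t : ZMod 2) (v w : PauliVec n) : sform (t • v) w = t * sform v w :=
  LinearMap.map_smul₂ (sympl n) t v w

theorem sform_smul_right (t : ZMod 2) (v w : PauliVec n) : sform v (t • w) = t * sform v w :=
  map_smul (sympl n v) t w

/-- The string with a given code. -/
def decode (f : Fin 4 → PauliVec n) (c : ℕ) : PauliVec n :=
  bitVal (c.testBit 0) • f 0 + bitVal (c.testBit 1) • f 1 + bitVal (c.testBit 2) • f 2 +
    bitVal (c.testBit 3) • f 3

theorem bitVal_xor (a b : Bool) : bitVal (a ^^ b) = bitVal a + bitVal b := by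
  cases a <;> cases b <;> rfl

theorem decode_xor (f : Fin 4 → PauliVec n) (c d : ℕ) :
    decode f (c ^^^ d) = decode f c + decode f d := by
  simp only [decode, Nat.testBit_xor, bitVal_xor, add_smul]
  abel

@[simp] theorem decode_zero (f : Fin 4 → PauliVec n) : decode f 0 = 0 := by
  simp [decode, bitVal]

theorem bitVal_codeForm (c d : ℕ) : bitVal (codeForm c d) =
    bitVal (c.testBit 0) * bitVal (d.testBit 1) + bitVal (c.testBit 1) * bitVal (d.testBit 0) +
      (bitVal (c.testBit 2) * bitVal (d.testBit 3) +
        bitVal (c.testBit 3) * bitVal (d.testBit 2)) := by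
  have h : ∀ a b : Bool, bitVal (a && b) = bitVal a * bitVal b := by decide
  simp only [codeForm, bitVal_xor, h]

theorem IsFrame.sform_decode {G : Submodule (ZMod 2) (PauliVec n)} {f : Fin 4 → PauliVec n}
    (hf : IsFrame G f) (c d : ℕ) :
    sform (decode f c) (decode f d) = bitVal (codeForm c d) := by
  rw [bitVal_codeForm]
  simp only [decode, sform_add_left, sform_add_right, sform_smul_left, sform_smul_right, hf.form]
  simp
  ring

theorem exists_bitVal (t : ZMod 2) : ∃ b, t = bitVal b := by
  rcases zmod_two_cases t with rfl | rfl
  · exact ⟨false, rfl⟩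
  · exact ⟨true, rfl⟩

theorem exists_decode (f : Fin 4 → PauliVec n) (t : Fin 4 → ZMod 2) :
    ∃ c < 16, decode f c = t 0 • f 0 + t 1 • f 1 + t 2 • f 2 + t 3 • f 3 := by
  have key : ∀ b0 b1 b2 b3 : Bool, ∃ c : Fin 16, c.val.testBit 0 = b0 ∧ c.val.testBit 1 = b1 ∧
      c.val.testBit 2 = b2 ∧ c.val.testBit 3 = b3 := by decide +kernel
  choose b hb using fun i => exists_bitVal (t i)
  obtain ⟨c, h0, h1, h2, h3⟩ := key (b 0) (b 1) (b 2) (b 3)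
  exact ⟨c, c.2, by rw [decode, h0, h1, h2, h3, hb, hb, hb, hb]⟩

/-- Symplectic Gram–Schmidt in `G^⊥`, where `G^⊥ / G` has dimension four. Subtracting frame
components from `x` leaves a vector orthogonal to `G` and the frame; it lies in `G`, as isotropic
subspaces have dimension at most `n`. -/
theorem exists_isFrame {G : Submodule (ZMod 2) (PauliVec n)}
    (hG : ∀ v ∈ G, ∀ w ∈ G, sform v w = 0) (hn : Module.finrank (ZMod 2) G + 2 = n) :
    ∃ f : Fin 4 → PauliVec n, IsFrame G f ∧
      ∀ x, (∀ g ∈ G, sform g x = 0) → ∃ c < 16, x + decode f c ∈ G := by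
  -- `S^⊥` has dimension at least `n`, too large to fit inside `G`.
  have hnot : ∀ S : Submodule (ZMod 2) (PauliVec n), Module.finrank (ZMod 2) S ≤ n →
      ∃ a, (∀ s ∈ S, sform s a = 0) ∧ a ∉ G := by
    intro S hS
    by_contra! hc
    have hle : (sympl n).orthogonal S ≤ G := fun a ha => hc a (mem_sympl_orthogonal.1 ha)
    have := Submodule.finrank_mono hle
    rw [finrank_sympl_orthogonal] at this
    omega
  have hpair : ∀ a, a ∉ G → ∃ b, (∀ g ∈ G, sform g b = 0) ∧ sform b a = 1 := by
    intro a ha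
    by_contra! hc
    exact ha (mem_of_forall_orthogonal fun w hw => (zmod_two_cases _).resolve_right (hc w hw))
  obtain ⟨a₁, ha₁, ha₁G⟩ := hnot G (by omega)
  obtain ⟨b₁, hb₁, hba₁⟩ := hpair a₁ ha₁G
  have hfin : ∀ (S : Submodule (ZMod 2) (PauliVec n)) (v : PauliVec n),
      Module.finrank (ZMod 2) (S ⊔ Submodule.span (ZMod 2) {v} : Submodule (ZMod 2) (PauliVec n)) ≤
        Module.finrank (ZMod 2) S + 1 := by
    intro S v
    by_cases hv : v ∈ S
    · rw [sup_eq_left.2 ((Submodule.span_singleton_le_iff_mem _ _).2 hv)]; omega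
    · rw [Submodule.finrank_sup_span_singleton hv]
  obtain ⟨a₂, ha₂, ha₂G⟩ := hnot (G ⊔ Submodule.span (ZMod 2) {a₁} ⊔ Submodule.span (ZMod 2) {b₁})
    ((hfin _ _).trans ((Nat.add_le_add_right (hfin _ _) 1).trans (by omega)))
  have ha₂g : ∀ g ∈ G, sform g a₂ = 0 := fun g hg =>
    ha₂ g (Submodule.mem_sup_left (Submodule.mem_sup_left hg))
  have ha₁₂ : sform a₁ a₂ = 0 :=
    ha₂ a₁ (Submodule.mem_sup_left (Submodule.mem_sup_right (Submodule.mem_span_singleton_self _)))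
  have hb₁a₂ : sform b₁ a₂ = 0 :=
    ha₂ b₁ (Submodule.mem_sup_right (Submodule.mem_span_singleton_self _))
  obtain ⟨w, hw, hwa₂⟩ := hpair a₂ ha₂G
  -- Removing the components of `w` along the first pair keeps its pairing with `a₂`, which is
  -- orthogonal to that pair.
  obtain ⟨b₂, hb₂⟩ : ∃ b₂, b₂ = w + sform w b₁ • a₁ + sform w a₁ • b₁ := ⟨_, rfl⟩
  have hab₁ := (sform_comm a₁ b₁).trans hba₁
  have ha₁b₂ : sform a₁ b₂ = 0 := by
    rw [hb₂]
    simp only [sform_add_right, sform_smul_right, sform_self, hab₁, sform_comm a₁ w, mul_zero,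
      mul_one, add_zero]
    exact CharTwo.add_self_eq_zero _
  have hb₁b₂ : sform b₁ b₂ = 0 := by
    rw [hb₂]
    simp only [sform_add_right, sform_smul_right, sform_self, hba₁, sform_comm b₁ w, mul_zero,
      mul_one, add_zero]
    exact CharTwo.add_self_eq_zero _
  have ha₂b₂ : sform a₂ b₂ = 1 := by
    rw [hb₂]
    simp only [sform_add_right, sform_smul_right, sform_comm a₂ w, sform_comm a₂ a₁,
      sform_comm a₂ b₁, ha₁₂, hb₁a₂, hwa₂, mul_zero, add_zero]
  have hb₂g : ∀ g ∈ G, sform g b₂ = 0 := fun g hg => by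
    rw [hb₂]
    simp only [sform_add_right, sform_smul_right, hw g hg, ha₁ g hg, hb₁ g hg, mul_zero, add_zero]
  have hf : IsFrame G ![a₁, b₁, a₂, b₂] := by
    constructor
    · intro i g hg
      fin_cases i
      · exact ha₁ g hg
      · exact hb₁ g hg
      · exact ha₂g g hg
      · exact hb₂g g hg
    · intro i j
      fin_cases i <;> fin_cases j <;>
        simp [hab₁, hba₁, ha₁₂, hb₁a₂, ha₁b₂, hb₁b₂, ha₂b₂, sform_comm a₂ a₁, sform_comm a₂ b₁,
          sform_comm b₂]
  refine ⟨_, hf, fun x hx => ?_⟩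
  obtain ⟨c, hc, hdec⟩ := exists_decode ![a₁, b₁, a₂, b₂]
    ![sform x b₁, sform x a₁, sform x b₂, sform x a₂]
  refine ⟨c, hc, ?_⟩
  obtain ⟨y, hy⟩ : ∃ y, y = x + decode ![a₁, b₁, a₂, b₂] c := ⟨_, rfl⟩
  rw [← hy]
  have hy' : y = x + (sform x b₁ • a₁ + sform x a₁ • b₁ + sform x b₂ • a₂ + sform x a₂ • b₂) := by
    rw [hy, hdec]; rfl
  have hyg : ∀ g ∈ G, sform g y = 0 := fun g hg => by
    rw [hy']
    simp only [sform_add_right, sform_smul_right, hx g hg, ha₁ g hg, hb₁ g hg, ha₂g g hg,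
      hb₂g g hg, mul_zero, add_zero]
  have hya₁ : sform a₁ y = 0 := by
    rw [hy']
    simp only [sform_add_right, sform_smul_right, sform_self, hab₁, ha₁₂, ha₁b₂, sform_comm a₁ x,
      mul_zero, mul_one, add_zero, zero_add]
    exact CharTwo.add_self_eq_zero _
  have hyb₁ : sform b₁ y = 0 := by
    rw [hy']
    simp only [sform_add_right, sform_smul_right, sform_self, hba₁, hb₁a₂, hb₁b₂, sform_comm b₁ x,
      mul_zero, mul_one, add_zero]
    exact CharTwo.add_self_eq_zero _
  have hya₂ : sform a₂ y = 0 := by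
    rw [hy']
    simp only [sform_add_right, sform_smul_right, sform_self, sform_comm a₂ a₁, sform_comm a₂ b₁,
      ha₁₂, hb₁a₂, ha₂b₂, sform_comm a₂ x, mul_zero, mul_one, add_zero, zero_add]
    exact CharTwo.add_self_eq_zero _
  have hyb₂ : sform b₂ y = 0 := by
    rw [hy']
    simp only [sform_add_right, sform_smul_right, sform_self, sform_comm b₂ a₁, sform_comm b₂ b₁,
      sform_comm b₂ a₂, ha₁b₂, hb₁b₂, ha₂b₂, sform_comm b₂ x, mul_zero, mul_one, add_zero, zero_add]
    exact CharTwo.add_self_eq_zero _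
  by_contra hyG
  -- otherwise `G`, `y`, `a₁`, `a₂` span an isotropic subspace that is too large
  have hI : ∀ S : Submodule (ZMod 2) (PauliVec n), (∀ v ∈ S, ∀ u ∈ S, sform v u = 0) →
      Module.finrank (ZMod 2) S ≤ n := fun S hS => by
    have := Submodule.finrank_mono (s := S) (t := (sympl n).orthogonal S)
      fun v hv => mem_sympl_orthogonal.2 fun u hu => hS u hu v hv
    rw [finrank_sympl_orthogonal] at this
    omega
  have hext : ∀ (S : Submodule (ZMod 2) (PauliVec n)) (v u : PauliVec n),
      (∀ s ∈ S, sform s v = 0) → (∀ s ∈ S, sform s u = 0) → sform v u = 0 →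
      ∀ s ∈ S ⊔ Submodule.span (ZMod 2) {v}, sform s u = 0 := by
    intro S v u _ hu hvu s hs
    obtain ⟨l, hl, rfl | rfl⟩ := mem_sup_span_iff.1 hs
    · exact hu _ hl
    · rw [sform_add_left, hu l hl, hvu, add_zero]
  have hext' : ∀ (S : Submodule (ZMod 2) (PauliVec n)) (v : PauliVec n),
      (∀ s ∈ S, ∀ u ∈ S, sform s u = 0) → (∀ s ∈ S, sform s v = 0) →
      ∀ s ∈ S ⊔ Submodule.span (ZMod 2) {v}, ∀ u ∈ S ⊔ Submodule.span (ZMod 2) {v},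
        sform s u = 0 := by
    intro S v hS hv s hs u hu
    obtain ⟨l, hl, rfl | rfl⟩ := mem_sup_span_iff.1 hu
    · exact hext S v _ hv (fun s hs => hS s hs _ hl) (by rw [sform_comm]; exact hv _ hl) s hs
    · exact hext S v _ hv
        (fun s hs => by rw [sform_add_right, hS s hs l hl, hv s hs, add_zero])
        (by rw [sform_add_right, sform_self, sform_comm, hv l hl, add_zero]) s hs
  have i1 := hext' G y hG hyg
  have o1 := hext G y a₁ hyg ha₁ (by rw [sform_comm, hya₁])
  have o1' := hext G y b₁ hyg hb₁ (by rw [sform_comm, hyb₁])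
  have o2 := hext G y a₂ hyg ha₂g (by rw [sform_comm, hya₂])
  have o2' := hext G y b₂ hyg hb₂g (by rw [sform_comm, hyb₂])
  have i2 := hext' _ a₁ i1 o1
  have p2 := hext _ a₁ a₂ o1 o2 ha₁₂
  have p2' := hext _ a₁ b₂ o1 o2' ha₁b₂
  have i3 := hext' _ a₂ i2 p2
  have n1 : a₁ ∉ G ⊔ Submodule.span (ZMod 2) {y} := fun h => by
    have := o1' _ h; rw [hab₁] at this; exact one_ne_zero this
  have n2 : a₂ ∉ G ⊔ Submodule.span (ZMod 2) {y} ⊔ Submodule.span (ZMod 2) {a₁} := fun h => by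
    have := p2' _ h; rw [ha₂b₂] at this; exact one_ne_zero this
  have := hI _ i3
  rw [Submodule.finrank_sup_span_singleton n2, Submodule.finrank_sup_span_singleton n1,
    Submodule.finrank_sup_span_singleton hyG] at this
  omega

theorem TwoMem.of_twoBits {T : Set (PauliVec n)} {f : Fin 4 → PauliVec n} {m a b : ℕ}
    (hT : ∀ c, m.testBit c = true → decode f c ∈ T) (h : twoBits m a b = true) :
    TwoMem T (decode f a) (decode f b) := by
  simp only [twoBits, Bool.or_eq_true, Bool.and_eq_true] at h
  rw [TwoMem, ← decode_xor]
  rcases h with (⟨h1, h2⟩ | ⟨h1, h2⟩) | ⟨h1, h2⟩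
  · exact Or.inl ⟨hT _ h1, hT _ h2⟩
  · exact Or.inr (Or.inl ⟨hT _ h1, hT _ h2⟩)
  · exact Or.inr (Or.inr ⟨hT _ h1, hT _ h2⟩)

theorem bitVal_eq_zero {b : Bool} : bitVal b = 0 ↔ b = false := by
  revert b; decide

/-- A Lagrangian subspace containing `G` is spanned by `G` and a line of the frame. -/
theorem exists_line {G L : Submodule (ZMod 2) (PauliVec n)} {f : Fin 4 → PauliVec n}
    (hf : IsFrame G f) (hfG : ∀ x, (∀ g ∈ G, sform g x = 0) → ∃ c < 16, x + decode f c ∈ G)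
    (hn : Module.finrank (ZMod 2) G + 2 = n) (hL : IsLagrangian L) (hGL : G ≤ L) :
    ∃ l ∈ codeLines, decode f l.1 ∈ L ∧ decode f l.2 ∈ L := by
  have hnot : ∀ S : Submodule (ZMod 2) (PauliVec n), Module.finrank (ZMod 2) S < n →
      ∃ x ∈ L, x ∉ S := fun S hS => by
    by_contra! hc
    have := Submodule.finrank_mono (s := L) (t := S) hc
    rw [hL.finrank_eq] at this
    omega
  have hcode : ∀ x ∈ L, ∃ c < 16, x + decode f c ∈ G ∧ decode f c ∈ L := fun x hx => by
    obtain ⟨c, hc, hcG⟩ := hfG x fun g hg => hL.sform_eq_zero (hGL hg) hx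
    refine ⟨c, hc, hcG, ?_⟩
    have := L.add_mem hx (hGL hcG)
    rwa [add_add_cancel_pauliVec] at this
  have hback : ∀ {x y : PauliVec n}, x = x + y + y := fun {x y} => by
    rw [add_assoc, add_self_pauliVec, add_zero]
  obtain ⟨x, hx, hxG⟩ := hnot G (by omega)
  obtain ⟨u, hu, huG, huL⟩ := hcode x hx
  obtain ⟨y, hy, hyG⟩ := hnot (G ⊔ Submodule.span (ZMod 2) {decode f u}) (by
    by_cases hv : decode f u ∈ G
    · rw [sup_eq_left.2 ((Submodule.span_singleton_le_iff_mem _ _).2 hv)]; omega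
    · rw [Submodule.finrank_sup_span_singleton hv]; omega)
  obtain ⟨v, hv, hvG, hvL⟩ := hcode y hy
  have hu0 : u ≠ 0 := by rintro rfl; exact hxG (by simpa using huG)
  have hv0 : v ≠ 0 := by
    rintro rfl; exact hyG (Submodule.mem_sup_left (by simpa using hvG))
  have huv : u ≠ v := by
    rintro rfl
    exact hyG (mem_sup_span_iff.2 ⟨_, hvG, Or.inr hback⟩)
  have hform : codeForm u v = false := by
    rw [← bitVal_eq_zero, ← hf.sform_decode]; exact hL.sform_eq_zero huL hvL
  obtain ⟨l, hl, h1, h2⟩ := exists_codeLine ⟨u, hu⟩ ⟨v, hv⟩ (by simpa [Fin.ext_iff] using hu0)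
    (by simpa [Fin.ext_iff] using hv0) (by simpa [Fin.ext_iff] using huv) hform
  have huvL : decode f (u ^^^ v) ∈ L := by rw [decode_xor]; exact L.add_mem huL hvL
  refine ⟨l, hl, ?_, ?_⟩
  · rcases h1 with h | h | h <;> rw [h] <;> assumption
  · rcases h2 with h | h | h <;> rw [h] <;> assumption

/-- Modulo `G`, an element of `L` is a code orthogonal to both generators of the line, hence a point
of the line or zero. So the line determines a Lagrangian subspace above `G`. -/
theorem le_of_line {G L M : Submodule (ZMod 2) (PauliVec n)} {f : Fin 4 → PauliVec n}
    (hf : IsFrame G f) (hfG : ∀ x, (∀ g ∈ G, sform g x = 0) → ∃ c < 16, x + decode f c ∈ G)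
    (hL : IsLagrangian L) (hGL : G ≤ L) (hGM : G ≤ M) {l : ℕ × ℕ} (hl : l ∈ codeLines)
    (h1 : decode f l.1 ∈ L) (h2 : decode f l.2 ∈ L) (h1' : decode f l.1 ∈ M)
    (h2' : decode f l.2 ∈ M) : L ≤ M := by
  intro x hx
  obtain ⟨c, hc, hcG⟩ := hfG x fun g hg => hL.sform_eq_zero (hGL hg) hx
  have hcL : decode f c ∈ L := by
    have := L.add_mem hx (hGL hcG)
    rwa [add_add_cancel_pauliVec] at this
  have hcM : decode f c ∈ M := by
    have e1 : codeForm c l.1 = false := by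
      rw [← bitVal_eq_zero, ← hf.sform_decode]; exact hL.sform_eq_zero hcL h1
    have e2 : codeForm c l.2 = false := by
      rw [← bitVal_eq_zero, ← hf.sform_decode]; exact hL.sform_eq_zero hcL h2
    rcases mem_codeLine l hl c hc e1 e2 with rfl | rfl | rfl | rfl
    · simp
    · exact h1'
    · exact h2'
    · rw [decode_xor]; exact M.add_mem h1' h2'
  have := M.add_mem (hGM hcG) hcM
  rwa [add_assoc, add_self_pauliVec, add_zero] at this

/-- Consistency fixes the sign of every nonzero string, so states of `s` are told apart by their
stabilizers alone. -/
theorem StabBy.eq_of_consistent {s : Set (Op n)} {κ : PauliVec n → ℤˣ} (hκ : Consistent s κ)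
    {ρ σ : Op n} (hρ : ρ ∈ s) (hσ : σ ∈ s) {L : Submodule (ZMod 2) (PauliVec n)}
    (hL : StabBy L ρ) (hM : StabBy L σ) : ρ = σ := by
  refine hL.ext hM fun v hv k hk => ?_
  by_cases hv0 : v = 0
  · subst hv0
    have h1 : k = 1 := sign_unique hL.ne_zero hk (by simp)
    simp [h1]
  · obtain ⟨l, hl⟩ := hM.sign v hv
    rwa [hκ.sign_eq hρ hv0 hk, ← hκ.sign_eq hσ hv0 hl]

/-- Six states whose stabilizers share a subspace of codimension two are partitioned. -/
theorem not_consistent_of_six {s : Set (Op n)} (hs : s ⊆ stabStates n)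
    {G : Submodule (ZMod 2) (PauliVec n)} (hG : ∀ ρ ∈ s, ∀ L, StabBy L ρ → G ≤ L)
    (hn : Module.finrank (ZMod 2) G + 2 = n) (h6 : 6 ≤ s.encard) (κ : PauliVec n → ℤˣ) :
    ¬ Consistent s κ := by
  classical
  intro hκ
  choose L hL using fun ρ : s => (mem_stabStates_iff.1 (hs ρ.2)).2
  have hne : s.Nonempty := by
    rw [← Set.encard_pos]; exact lt_of_lt_of_le (by norm_num) h6
  obtain ⟨ρ₀, hρ₀⟩ := hne
  have hGL : ∀ ρ : s, G ≤ L ρ := fun ρ => hG ρ ρ.2 _ (hL ρ)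
  obtain ⟨f, hf, hfG⟩ := exists_isFrame (fun v hv w hw =>
    (hL ⟨ρ₀, hρ₀⟩).lag.sform_eq_zero (hGL _ hv) (hGL _ hw)) hn
  choose l hl h1 h2 using fun ρ : s => exists_line hf hfG hn (hL ρ).lag (hGL ρ)
  have hinj : Function.Injective l := fun ρ σ h => by
    have e : L ρ = L σ := (hL ρ).lag.eq_of_le (hL σ).lag
      (le_of_line hf hfG (hL ρ).lag (hGL ρ) (hGL σ) (hl ρ) (h1 ρ) (h2 ρ) (h ▸ h1 σ) (h ▸ h2 σ))
    exact Subtype.ext (StabBy.eq_of_consistent hκ ρ.2 σ.2 (hL ρ) (e ▸ hL σ))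
  have hbits : ∀ ρ : s, ∀ c, (lineBits (l ρ)).testBit c = true → decode f c ∈ stabUnion s := by
    intro ρ c hc
    simp only [lineBits, Nat.testBit_or, Bool.or_eq_true, Nat.testBit_two_pow,
      decide_eq_true_eq] at hc
    refine mem_stabUnion ρ.2 (hL ρ) ?_
    rcases hc with (rfl | rfl) | rfl
    · exact h1 ρ
    · exact h2 ρ
    · rw [decode_xor]; exact (L ρ).add_mem (h1 ρ) (h2 ρ)
  obtain ⟨T, hT, hTB⟩ := exists_hasSquare (fun c => decode f c ∈ stabUnion s) codeLines 6 0
    alwaysSquare_codeLines (by simp) (by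
      have hsub : Set.range l ⊆ ((codeLines.filter fun l =>
          ∀ c, (lineBits l).testBit c = true → decode f c ∈ stabUnion s).toFinset : Set (ℕ × ℕ)) := by
        rintro _ ⟨ρ, rfl⟩
        simpa using ⟨hl ρ, hbits ρ⟩
      have h := Set.encard_le_encard hsub
      rw [Set.encard_coe_eq_coe_finsetCard,
        List.toFinset_card_of_nodup (nodup_codeLines.filter _), ← Set.image_univ,
        hinj.encard_image, Set.encard_univ, ← Set.encard] at h
      exact_mod_cast h6.trans h)
  obtain ⟨q, hq, hsq⟩ := List.any_eq_true.1 hT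
  simp only [Bool.and_eq_true] at hsq
  obtain ⟨⟨⟨⟨⟨r1, r2⟩, r3⟩, c1⟩, c2⟩, c3⟩ := hsq
  obtain ⟨f1, f2, f3, f4, f5, f6⟩ := codeSquare_form q hq
  have r3' := TwoMem.of_twoBits hTB r3
  have c3' := TwoMem.of_twoBits hTB c3
  rw [decode_xor, decode_xor] at r3' c3'
  exact hκ.false_of_square hs (by rw [hf.sform_decode, f1]; rfl) (by rw [hf.sform_decode, f2]; rfl)
    (by rw [hf.sform_decode, f3]; rfl) (by rw [hf.sform_decode, f4]; rfl)
    (by rw [hf.sform_decode, f5]; rfl) (by rw [hf.sform_decode, f6]; rfl)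
    (TwoMem.of_twoBits hTB r1) (TwoMem.of_twoBits hTB r2) r3' (TwoMem.of_twoBits hTB c1)
    (TwoMem.of_twoBits hTB c2) c3'

/-- Sets of at least six two-qubit states have partitioning measurements. -/
theorem exists_isPartitioning {s : Set (Op 2)} (hs : s ⊆ stabStates 2) (h6 : 6 ≤ s.encard) :
    ∃ O : PauliObs 2, O.op ≠ 1 ∧ O.op ≠ -1 ∧ IsPartitioning O s := by
  by_contra! hc
  have hv : ∀ v : PauliVec 2, ∃ k : ℤˣ, v ≠ 0 → (∀ ρ ∈ s, born (strProj v k) ρ ≠ 0) ∧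
      ∀ ρ ∈ s, ∀ σ ∈ s, (post (strProj v k) ρ * post (strProj v k) σ).trace ≠ 0 := by
    intro v
    by_cases hv0 : v = 0
    · exact ⟨1, fun h => absurd hv0 h⟩
    -- A nonzero string is not `±1`, so it is a candidate; its failure to partition supplies the
    -- outcome `κ v`.
    have hne : ∀ c : ℂ, strOp v ≠ c • (1 : Op 2) := fun c h => by
      rw [← strOp_zero, ← one_smul ℂ (strOp v)] at h
      exact hv0 (eq_of_smul_strOp one_ne_zero h)
    have := hc (strObs v) (show strOp v ≠ 1 by simpa using hne 1)
      (show strOp v ≠ -1 by simpa using hne (-1))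
    simp only [IsPartitioning, not_forall, not_or, not_exists, not_and] at this
    obtain ⟨k, h1, h2⟩ := this
    exact ⟨k, fun _ => ⟨h1, h2⟩⟩
  choose κ hκ using hv
  exact not_consistent_of_six (G := ⊥) hs (fun _ _ _ _ => bot_le) (by simp) h6 κ hκ

/-! ### Three classes of Lagrangian subspaces. -/

/-- For a Lagrangian subspace `L` and strings `o₀ ∈ L` and `o₁` that anticommute, each Lagrangian
subspace contains one of `o₀`, `o₁`, `o₀ + o₁` up to elements of `L` orthogonal to `o₁`. -/
theorem IsLagrangian.exists_mem_coset {L M : Submodule (ZMod 2) (PauliVec n)}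
    (hL : IsLagrangian L) (hM : IsLagrangian M) {o₀ o₁ : PauliVec n} (h₀ : o₀ ∈ L)
    (h₁ : sform o₁ o₀ = 1) :
    ∃ q, (q = o₀ ∨ q = o₁ ∨ q = o₀ + o₁) ∧ ∃ p ∈ M, p + q ∈ L ∧ sform o₁ (p + q) = 0 := by
  set K := L ⊓ LinearMap.ker (sympl n o₁) with hK
  have hmemK : ∀ x, x ∈ K ↔ x ∈ L ∧ sform o₁ x = 0 := fun x => Iff.rfl
  -- If `M ∩ K^⊥ ⊆ K`, then `o₀` is orthogonal to `(M + K)^⊥`, hence lies in `M + K`; its part in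
  -- `M` lies in `K^⊥` and so in `K`, contradicting `o₀ ∉ K`.
  obtain ⟨p, hp, hpK, hpK'⟩ : ∃ p ∈ M, (∀ x ∈ K, sform x p = 0) ∧ p ∉ K := by
    by_contra! hc
    have h : o₀ ∈ M ⊔ K := mem_of_forall_orthogonal fun w hw => by
      have hwM : w ∈ M := (hM w).2 fun y hy => by
        rw [sform_comm]; exact hw y (Submodule.mem_sup_left hy)
      have hwK := hc w hwM fun x hx => hw x (Submodule.mem_sup_right hx)
      exact hL.sform_eq_zero ((hmemK w).1 hwK).1 h₀
    obtain ⟨l, hl, k, hk, hlk⟩ := Submodule.mem_sup.1 h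
    have hlK := hc l hl fun x hx => by
      have : l = o₀ + k := by rw [← hlk, add_assoc, add_self_pauliVec, add_zero]
      rw [this]
      exact hL.sform_eq_zero ((hmemK x).1 hx).1 (L.add_mem h₀ ((hmemK k).1 hk).1)
    have := ((hmemK _).1 (K.add_mem hlK hk)).2
    rw [hlk, h₁] at this
    exact one_ne_zero this
  have h₁' := (sform_comm o₀ o₁).trans h₁
  -- The component of `p` in the hyperbolic plane of `o₀` and `o₁`. The rest, `p + q`, is orthogonal
  -- to `K`, `o₀` and `o₁`, so it lies in `K`; as `p ∉ K`, `q` is nonzero.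
  obtain ⟨q, hq⟩ : ∃ q, q = sform p o₁ • o₀ + sform p o₀ • o₁ := ⟨_, rfl⟩
  have hpq : sform o₁ (p + q) = 0 := by
    rw [hq]
    simp only [sform_add_right, sform_smul_right, sform_self, h₁, sform_comm o₁ p, mul_one,
      mul_zero, add_zero]
    exact CharTwo.add_self_eq_zero _
  have hpqK : ∀ x ∈ K, sform x (p + q) = 0 := fun x hx => by
    rw [hq]
    simp only [sform_add_right, sform_smul_right, hpK x hx,
      hL.sform_eq_zero ((hmemK x).1 hx).1 h₀, (sform_comm x o₁).trans ((hmemK x).1 hx).2, mul_zero,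
      add_zero]
  have hpq₀ : sform o₀ (p + q) = 0 := by
    rw [hq]
    simp only [sform_add_right, sform_smul_right, sform_self, h₁', sform_comm o₀ p, mul_one,
      mul_zero, zero_add]
    exact CharTwo.add_self_eq_zero _
  have hpqL : p + q ∈ L := (hL _).2 fun y hy => by
    rw [sform_comm]
    rcases zmod_two_cases (sform o₁ y) with h | h
    · exact hpqK y ((hmemK y).2 ⟨hy, h⟩)
    · have := hpqK (y + o₀) ((hmemK _).2 ⟨L.add_mem hy h₀, by
        rw [sform_add_right, h, h₁]; exact CharTwo.add_self_eq_zero _⟩)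
      rwa [sform_add_left, hpq₀, add_zero] at this
  refine ⟨q, ?_, p, hp, hpqL, hpq⟩
  rcases zmod_two_cases (sform p o₀) with h0 | h0 <;>
    rcases zmod_two_cases (sform p o₁) with h1 | h1
  · exfalso
    have : q = 0 := by rw [hq, h0, h1]; simp
    rw [this, add_zero] at hpqL hpq
    exact hpK' ((hmemK p).2 ⟨hpqL, hpq⟩)
  · left; rw [hq, h0, h1]; simp
  · right; left; rw [hq, h0, h1]; simp
  · right; right; rw [hq, h0, h1]; simp

/-! ### Simulations -/

/-- The measurement of a single string. -/
def strMeas (v : PauliVec n) : JointMeas n where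
  len := 1
  obs := fun _ => strObs v
  comm := fun _ _ => Commute.refl _

namespace Simulation

variable {Λ : Type*} (S : Simulation n Λ)

/-- Outcome and new internal state are drawn from `l` alone, so the same choice serves every `ρ`
whose support contains `l`. -/
theorem exists_outcome (hU : S.StateUpdate) (l : Λ) (v : PauliVec n) :
    ∃ (k : ℤˣ) (l' : Λ), ∀ ρ, l ∈ S.supp ρ →
      born (strProj v k) ρ ≠ 0 ∧ l' ∈ S.supp (post (strProj v k) ρ) := by
  obtain ⟨o, ho⟩ := (S.ξ (strMeas v) l).support_nonempty
  obtain ⟨l', hl'⟩ := (S.Γ ⟨strMeas v, o⟩ l).support_nonempty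
  have hproj : (⟨strMeas v, o⟩ : Event n).proj = strProj v (o (0 : Fin 1)) := by
    rw [Event.proj]
    exact (congrArg List.prod (List.ofFn_succ (n := 0))).trans (by simp [strProj, strMeas])
  refine ⟨o (0 : Fin 1), l', fun ρ hρ => ?_⟩
  have hb : born (strProj v (o (0 : Fin 1))) ρ ≠ 0 := by
    obtain ⟨R, rfl, hR⟩ := hρ
    have := S.possible_of_mem R ⟨strMeas v, o⟩ l hR ho
    rwa [hproj] at this
  refine ⟨hb, ?_⟩
  have := hU ρ ⟨strMeas v, o⟩ l (by rwa [hproj]) hρ ho hl'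
  rwa [hproj] at this

theorem trace_mul_ne_zero (hS : S.SSD) {l : Λ} {ρ σ : Op n} (hρ : l ∈ S.supp ρ)
    (hσ : l ∈ S.supp σ) : (ρ * σ).trace ≠ 0 := fun h => by
  have h2 : l ∈ S.supp ρ ∩ S.supp σ := ⟨hρ, hσ⟩
  rw [hS ρ σ h] at h2
  exact h2

/-- If an internal state is compatible with all states in `s`, and their stabilizers share a
subspace of codimension `m + 2`, there are at most `5 * 3 ^ m` of them. -/
theorem encard_le_of_mem_supp (hU : S.StateUpdate) (hS : S.SSD) (m : ℕ) :
    ∀ (l : Λ) (s : Set (Op n)) (G : Submodule (ZMod 2) (PauliVec n)), s ⊆ stabStates n →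
      (∀ ρ ∈ s, l ∈ S.supp ρ) → (∀ ρ ∈ s, ∀ L, StabBy L ρ → G ≤ L) →
      Module.finrank (ZMod 2) G + 2 + m = n → s.encard ≤ ((5 * 3 ^ m : ℕ) : ℕ∞) := by
  induction m with
  | zero =>
    intro l s G hs hl hG hn
    choose κ l' hκ using S.exists_outcome hU l
    have hcons : Consistent s κ := fun v _ => ⟨fun ρ hρ => (hκ v ρ (hl ρ hρ)).1,
      fun ρ hρ σ hσ => S.trace_mul_ne_zero hS (hκ v ρ (hl ρ hρ)).2 (hκ v σ (hl σ hσ)).2⟩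
    by_contra hc
    rw [not_le] at hc
    exact not_consistent_of_six hs hG hn (by
      have := Order.add_one_le_of_lt hc
      norm_num at this
      exact this) κ hcons
  | succ m ih =>
    intro l s G hs hl hG hn
    choose κ l' hκ using S.exists_outcome hU l
    have hcons : Consistent s κ := fun v _ => ⟨fun ρ hρ => (hκ v ρ (hl ρ hρ)).1,
      fun ρ hρ σ hσ => S.trace_mul_ne_zero hS (hκ v ρ (hl ρ hρ)).2 (hκ v σ (hl σ hσ)).2⟩
    -- Two different states are needed to supply the anticommuting strings `o₀` and `o₁`.
    by_cases hsub : s.Subsingleton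
    · refine (Set.encard_le_one_iff_subsingleton.2 hsub).trans ?_
      exact_mod_cast Nat.one_le_iff_ne_zero.2 (by positivity)
    obtain ⟨ρ₀, hρ₀, ρ₁, hρ₁, hne⟩ := Set.not_subsingleton_iff.1 hsub
    obtain ⟨-, L₀, hL₀⟩ := mem_stabStates_iff.1 (hs hρ₀)
    obtain ⟨-, L₁, hL₁⟩ := mem_stabStates_iff.1 (hs hρ₁)
    obtain ⟨o₁, ho₁, ho₁'⟩ : ∃ o ∈ L₁, o ∉ L₀ := by
      by_contra! hc
      have e : L₁ = L₀ := hL₁.lag.eq_of_le hL₀.lag hc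
      exact hne (StabBy.eq_of_consistent hcons hρ₀ hρ₁ hL₀ (e ▸ hL₁))
    obtain ⟨o₀, ho₀, h₁₀⟩ : ∃ o ∈ L₀, sform o₁ o = 1 := by
      by_contra! hc
      exact ho₁' ((hL₀.lag o₁).2 fun w hw => (zmod_two_cases _).resolve_right (hc w hw))
    have h₀₁ := (sform_comm o₀ o₁).trans h₁₀
    have hGL₀ := hG ρ₀ hρ₀ L₀ hL₀
    have hGL₁ := hG ρ₁ hρ₁ L₁ hL₁
    have hGo₀ : ∀ g ∈ G, sform o₀ g = 0 := fun g hg => hL₀.lag.sform_eq_zero ho₀ (hGL₀ hg)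
    have hGo₁ : ∀ g ∈ G, sform o₁ g = 0 := fun g hg => hL₁.lag.sform_eq_zero ho₁ (hGL₁ hg)
    have ho₀G : o₀ ∉ G := fun h => by
      rw [hGo₁ o₀ h] at h₁₀; exact zero_ne_one h₁₀
    have ho₁G : o₁ ∉ G := fun h => ho₁' (hGL₀ h)
    -- the states in one coset are not merged by a suitable measurement
    have hclass : ∀ q o, o ∈ stabUnion s → (∀ g ∈ G, sform o g = 0) → o ∉ G → sform o q = 1 →
        (∀ x ∈ L₀, sform o₁ x = 0 → sform q x = 0) → (∀ x ∈ L₀, sform o₁ x = 0 → sform o x = 0) →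
        {ρ ∈ s | ∃ p, (∃ k : ℤˣ, strOp p * ρ = unitSign k • ρ) ∧ p + q ∈ L₀ ∧
          sform o₁ (p + q) = 0}.encard ≤ ((5 * 3 ^ m : ℕ) : ℕ∞) := by
      intro q o ho hGo hoG hoq hqK hoK
      have hinj : Set.InjOn (post (strProj o (κ o)))
          {ρ ∈ s | ∃ p, (∃ k : ℤˣ, strOp p * ρ = unitSign k • ρ) ∧ p + q ∈ L₀ ∧
            sform o₁ (p + q) = 0} := by
        rintro ρ ⟨hρ, p, hp, hpL, hpo⟩ σ ⟨hσ, p', hp', hpL', hpo'⟩ heq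
        obtain ⟨-, L, hL⟩ := mem_stabStates_iff.1 (hs hρ)
        obtain ⟨-, M, hM⟩ := mem_stabStates_iff.1 (hs hσ)
        rw [← hL.mem_iff] at hp
        rw [← hM.mem_iff] at hp'
        have e1 : p = q + (p + q) := by rw [add_comm p, add_add_cancel_pauliVec]
        have e2 : p' = q + (p' + q) := by rw [add_comm p', add_add_cancel_pauliVec]
        have hop : ∀ {x}, x = q + (x + q) → x + q ∈ L₀ → sform o₁ (x + q) = 0 →
            sform o x = 1 := fun {x} e hx hx' => by
          rw [e, sform_add_right, hoq, hoK _ hx hx', add_zero]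
        have hpp : p + p' = (p + q) + (p' + q) := by
          rw [add_add_add_comm, add_self_pauliVec, add_zero]
        have hmeas : measSub L o = measSub M o := by
          have h1 := hL.post (hκ o ρ (hl ρ hρ)).1
          have h2 := hM.post (hκ o σ (hl σ hσ)).1
          rw [heq] at h1
          exact h1.unique h2
        have e : L = M := hcons.eq_of_measSub_eq hs hρ hσ hL hM ho hp hp' (hop e1 hpL hpo)
          (hop e2 hpL' hpo')
          (by
            have h : sform p p' = sform (q + (p + q)) (q + (p' + q)) := by rw [← e1, ← e2]
            rw [h, sform_add_left, sform_add_right q, sform_add_right (p + q), sform_self,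
              hqK _ hpL' hpo', sform_comm _ q, hqK _ hpL hpo, hL₀.lag.sform_eq_zero hpL hpL']
            simp)
          (by rw [hpp]; exact mem_stabUnion hρ₀ hL₀ (L₀.add_mem hpL hpL')) hmeas
        exact StabBy.eq_of_consistent hcons hρ hσ hL (e ▸ hM)
      -- Pass to the post-measurement states: they share the internal state `l' o`, and their
      -- stabilizers contain `G` and the new string `o`.
      rw [← hinj.encard_image]
      refine ih (l' o) _ (G ⊔ Submodule.span (ZMod 2) {o}) ?_ ?_ ?_ ?_
      · rintro _ ⟨ρ, ⟨hρ, -⟩, rfl⟩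
        exact post_mem_stabStates (hs hρ) (hκ o ρ (hl ρ hρ)).1
      · rintro _ ⟨ρ, ⟨hρ, -⟩, rfl⟩
        exact (hκ o ρ (hl ρ hρ)).2
      · rintro _ ⟨ρ, ⟨hρ, -⟩, rfl⟩ M hM
        obtain ⟨-, L, hL⟩ := mem_stabStates_iff.1 (hs hρ)
        rw [hM.unique (hL.post (hκ o ρ (hl ρ hρ)).1)]
        exact sup_le_sup_right (fun g hg => ⟨hG ρ hρ L hL hg, hGo g hg⟩) _
      · rw [Submodule.finrank_sup_span_singleton hoG]
        omega
    have hK₀ : ∀ x ∈ L₀, sform o₁ x = 0 → sform o₀ x = 0 := fun x hx _ =>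
      hL₀.lag.sform_eq_zero ho₀ hx
    -- Each class is measured with whichever of `o₀`, `o₁` anticommutes with its representative; for
    -- `o₀ + o₁` either would do.
    have c₀ := hclass o₀ o₁ (mem_stabUnion hρ₁ hL₁ ho₁) hGo₁ ho₁G h₁₀ hK₀ (fun x _ h => h)
    have c₁ := hclass o₁ o₀ (mem_stabUnion hρ₀ hL₀ ho₀) hGo₀ ho₀G h₀₁ (fun x _ h => h) hK₀
    have c₂ := hclass (o₀ + o₁) o₀ (mem_stabUnion hρ₀ hL₀ ho₀) hGo₀ ho₀G
      (by rw [sform_add_right, sform_self, h₀₁, zero_add])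
      (fun x hx h => by rw [sform_add_left, hK₀ x hx h, h, add_zero]) hK₀
    refine le_trans (Set.encard_le_encard fun ρ hρ => ?_)
      ((Set.encard_union_le _ _).trans (add_le_add ((Set.encard_union_le _ _).trans
        (add_le_add c₀ c₁)) c₂)) |>.trans (by rw [pow_succ]; norm_cast; omega)
    obtain ⟨-, M, hM⟩ := mem_stabStates_iff.1 (hs hρ)
    obtain ⟨q, hq, p, hp, h⟩ := hL₀.lag.exists_mem_coset hM.lag ho₀ h₁₀
    rcases hq with rfl | rfl | rfl
    · exact Or.inl (Or.inl ⟨hρ, p, hM.sign p hp, h⟩)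
    · exact Or.inl (Or.inr ⟨hρ, p, hM.sign p hp, h⟩)
    · exact Or.inr ⟨hρ, p, hM.sign p hp, h⟩

/-- More than `5 * 3 ^ (n - 2)` pure stabilizer states have no common internal state. -/
theorem iInter_supp_eq_empty (hn : 2 ≤ n) (hU : S.StateUpdate) (hS : S.SSD) {s : Set (Op n)}
    (hs : s ⊆ stabStates n) (hc : ((5 * 3 ^ (n - 2) : ℕ) : ℕ∞) < s.encard) :
    ⋂ ρ ∈ s, S.supp ρ = ∅ := by
  by_contra h
  obtain ⟨l, hl⟩ := Set.nonempty_iff_ne_empty.2 h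
  rw [Set.mem_iInter₂] at hl
  refine hc.not_ge (S.encard_le_of_mem_supp hU hS (n - 2) l s ⊥ hs hl (fun _ _ _ _ => bot_le) ?_)
  rw [finrank_bot]
  omega

end Simulation

/-! ### Existence of stabilizer states -/

theorem born_one_add_born_neg_one (v : PauliVec n) (ρ : Op n) :
    born (strProj v 1) ρ + born (strProj v (-1)) ρ = ρ.trace := by
  have h : strProj v 1 + strProj v (-1) = 1 := by
    rw [strProj_eq, strProj_eq, ← smul_add, unitSign_one, unitSign_neg_one, one_smul, neg_smul,
      one_smul, add_add_add_comm, add_neg_cancel, add_zero, ← two_smul ℂ, smul_smul]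
    norm_num
  rw [born, born, ← Matrix.trace_add, ← add_mul, h, one_mul]

/-- Starting from a computational basis state, measure the strings in turn: one outcome always has
nonzero probability, and commuting measurements preserve the earlier signs. -/
theorem exists_isPure_sign (T : Finset (PauliVec n)) (hT : ∀ v ∈ T, ∀ w ∈ T, sform v w = 0) :
    ∃ ρ : Op n, IsPure ρ ∧ ∀ v ∈ T, ∃ k : ℤˣ, strOp v * ρ = unitSign k • ρ := by
  classical
  induction T using Finset.induction with
  | empty =>
    refine ⟨_, ⟨Pi.single 0 1, ?_, rfl⟩, by simp⟩
    simp
  | insert v T hv ih =>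
    obtain ⟨ρ, hρ, hs⟩ := ih fun x hx y hy =>
      hT x (Finset.mem_insert_of_mem hx) y (Finset.mem_insert_of_mem hy)
    obtain ⟨k, hk⟩ : ∃ k : ℤˣ, born (strProj v k) ρ ≠ 0 := by
      by_contra! hc
      have := born_one_add_born_neg_one v ρ
      rw [hc, hc, hρ.trace_one, add_zero] at this
      exact zero_ne_one this
    refine ⟨_, hρ.post (strProj_mul_self v k) (strProj_conjTranspose v k) hk, fun w hw => ?_⟩
    rcases Finset.mem_insert.1 hw with rfl | hw
    · exact ⟨k, strOp_mul_post_self w k ρ⟩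
    · obtain ⟨l, hl⟩ := hs w hw
      exact ⟨l, strOp_mul_post_of_commute hl
        (hT v (Finset.mem_insert_self v T) w (Finset.mem_insert_of_mem hw))⟩

theorem IsLagrangian.exists_stabBy {L : Submodule (ZMod 2) (PauliVec n)} (hL : IsLagrangian L) :
    ∃ ρ : Op n, IsPure ρ ∧ StabBy L ρ := by
  classical
  obtain ⟨ρ, hρ, hs⟩ := exists_isPure_sign (Finset.univ.filter (· ∈ L)) fun v hv w hw =>
    hL.sform_eq_zero (Finset.mem_filter.1 hv).2 (Finset.mem_filter.1 hw).2
  exact ⟨ρ, hρ, hL, hρ.herm, hρ.trace_one, fun v hv => hs v (by simpa using hv)⟩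

/-! ### States with a given stabilizer -/

/-- Conjugation by a Pauli string. -/
def strConj (ρ : Op n) (u : PauliVec n) : Op n := strOp u * ρ * strOp u

theorem bitSign_mul_unitSign (t : ZMod 2) (k : ℤˣ) :
    bitSign t * unitSign k = unitSign (if t = 0 then k else -k) := by
  rcases zmod_two_cases t with rfl | rfl <;> simp [unitSign_neg]

theorem strOp_mul_strConj {ρ : Op n} {v : PauliVec n} {k : ℤˣ}
    (h : strOp v * ρ = unitSign k • ρ) (u : PauliVec n) :
    strOp v * strConj ρ u = (bitSign (sform v u) * unitSign k) • strConj ρ u := by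
  rw [strConj, ← mul_assoc, ← mul_assoc, strOp_mul_comm, smul_mul_assoc, smul_mul_assoc,
    mul_assoc (strOp u) (strOp v), h, mul_smul_comm, smul_mul_assoc, smul_smul]

theorem IsPure.strConj {ρ : Op n} (h : IsPure ρ) (u : PauliVec n) : IsPure (strConj ρ u) := by
  obtain ⟨ψ, h1, rfl⟩ := h
  refine ⟨strOp u *ᵥ ψ, ?_, ?_⟩
  · rw [Matrix.star_mulVec, strOp_conjTranspose, Matrix.dotProduct_mulVec, Matrix.vecMul_vecMul,
      strOp_mul_self, Matrix.vecMul_one, h1]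
  · rw [StabSim.strConj, Matrix.mul_vecMulVec, Matrix.vecMulVec_mul, Matrix.star_mulVec,
      strOp_conjTranspose]

namespace StabBy

variable {L : Submodule (ZMod 2) (PauliVec n)} {ρ σ : Op n}

theorem of_isPure (hL : IsLagrangian L) (hρ : IsPure ρ)
    (hs : ∀ v ∈ L, ∃ k : ℤˣ, strOp v * ρ = unitSign k • ρ) : StabBy L ρ :=
  ⟨hL, hρ.herm, hρ.trace_one, hs⟩

theorem strConj (h : StabBy L ρ) (hρ : IsPure ρ) (u : PauliVec n) :
    StabBy L (strConj ρ u) :=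
  of_isPure h.lag (hρ.strConj u) fun v hv => by
    obtain ⟨k, hk⟩ := h.sign v hv
    exact ⟨_, by rw [strOp_mul_strConj hk, bitSign_mul_unitSign]⟩

/-- Conjugation by `u` multiplies the sign of `v` by `(-1) ^ sform v u`, so all signs agree exactly
when `u + u'` is orthogonal to `L`. -/
theorem strConj_eq_iff (h : StabBy L ρ) (hρ : IsPure ρ) (u u' : PauliVec n) :
    StabSim.strConj ρ u = StabSim.strConj ρ u' ↔ u + u' ∈ L := by
  have hbit : ∀ {s t : ZMod 2}, bitSign s = bitSign t → s + t = 0 := fun {s t} e => by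
    rcases zmod_two_cases s with rfl | rfl <;> rcases zmod_two_cases t with rfl | rfl
    · simp
    · norm_num at e
    · norm_num at e
    · exact CharTwo.add_self_eq_zero _
  constructor
  · intro e
    refine (h.lag _).2 fun v hv => ?_
    obtain ⟨k, hk⟩ := h.sign v hv
    have h1 := strOp_mul_strConj hk u
    rw [e, strOp_mul_strConj hk u'] at h1
    have h2 := smul_left_injective ℂ (h.strConj hρ u').ne_zero h1
    rw [sform_comm, sform_add_right, add_comm]
    exact hbit (mul_right_cancel₀ (unitSign_ne_zero k) h2)
  · intro hu
    refine (h.strConj hρ u).ext (h.strConj hρ u') fun v hv k hk => ?_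
    obtain ⟨l, hl⟩ := h.sign v hv
    have h0 := h.lag.sform_eq_zero hv hu
    rw [sform_add_right] at h0
    have h1 : sform v u' = sform v u := by
      rw [← CharTwo.add_eq_zero (R := ZMod 2), add_comm, h0]
    rw [strOp_mul_strConj hl] at hk ⊢
    rw [h1, smul_left_injective ℂ (h.strConj hρ u).ne_zero hk]

/-- The conjugates of `ρ` sum to a nonzero multiple of the identity, so one of them is not
orthogonal to `σ`. Having the same stabilizer, it must then have the same signs. -/
theorem exists_strConj_eq (h : StabBy L ρ) (hρ : IsPure ρ) (hσ : StabBy L σ) :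
    ∃ u, StabSim.strConj ρ u = σ := by
  have h1 : ((∑ u : PauliVec n, StabSim.strConj ρ u) * σ).trace ≠ 0 := by
    simp only [StabSim.strConj, sum_strOp_conj, h.trace_one, smul_mul_assoc, one_mul,
      Matrix.trace_smul, hσ.trace_one]
    simp
  rw [Finset.sum_mul, Matrix.trace_sum] at h1
  obtain ⟨u, -, hu⟩ := Finset.exists_ne_zero_of_sum_ne_zero h1
  refine ⟨u, (h.strConj hρ u).ext hσ fun v hv k hk => ?_⟩
  obtain ⟨l, hl⟩ := hσ.sign v hv
  by_cases hkl : l = k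
  · rw [hl, hkl]
  · rw [units_eq_neg_of_ne hkl] at hl
    exact absurd (trace_mul_eq_zero_of_sign ((h.strConj hρ u).mul_right hk) hl) hu

end StabBy

/-- Pauli conjugation is transitive on these states, and the orbit is a copy of `PauliVec n ⧸ L`, of
dimension `n`. -/
theorem IsLagrangian.card_states {L : Submodule (ZMod 2) (PauliVec n)} (hL : IsLagrangian L) :
    Nat.card {ρ : Op n // IsPure ρ ∧ StabBy L ρ} = 2 ^ n := by
  obtain ⟨ρ, hρ, h⟩ := hL.exists_stabBy
  have hr : Set.range (strConj ρ) = {σ | IsPure σ ∧ StabBy L σ} := by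
    ext σ
    exact ⟨by rintro ⟨u, rfl⟩; exact ⟨hρ.strConj u, h.strConj hρ u⟩,
      fun hσ => h.exists_strConj_eq hρ hσ.2⟩
  have hq : Setoid.ker (strConj ρ) = L.quotientRel := by
    ext u u'
    rw [Setoid.ker_def, Submodule.quotientRel_def, h.strConj_eq_iff hρ]
    rw [show u - u' = u + u' by rw [sub_eq_iff_eq_add, add_assoc, add_self_pauliVec, add_zero]]
  have h1 : Nat.card (Set.range (strConj ρ)) = Nat.card (PauliVec n ⧸ L) := by
    rw [← Nat.card_congr (Setoid.quotientKerEquivRange (strConj ρ)), hq]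
    rfl
  have h2 := L.finrank_quotient_add_finrank
  rw [hL.finrank_eq, finrank_pauliVec] at h2
  rw [hr] at h1
  refine h1.trans ?_
  rw [Module.natCard_eq_pow_finrank (K := ZMod 2), show Module.finrank (ZMod 2) (PauliVec n ⧸ L) = n
    by omega]
  simp

/-! ### The number of Lagrangian subspaces -/

/-- Linearly independent tuples of pairwise commuting strings. -/
abbrev IsotropicTuple (n k : ℕ) : Type :=
  {s : Fin k → PauliVec n // LinearIndependent (ZMod 2) s ∧ ∀ i j, sform (s i) (s j) = 0}

theorem mem_orthogonal_span_range {k : ℕ} {s : Fin k → PauliVec n} {v : PauliVec n} :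
    v ∈ (sympl n).orthogonal (Submodule.span (ZMod 2) (Set.range s)) ↔
      ∀ i, sform (s i) v = 0 := by
  rw [mem_sympl_orthogonal]
  refine ⟨fun h i => h _ (Submodule.subset_span ⟨i, rfl⟩), fun h w hw => ?_⟩
  have h2 : Submodule.span (ZMod 2) (Set.range s) ≤ LinearMap.ker (sympl n v) := by
    rw [Submodule.span_le]
    rintro _ ⟨i, rfl⟩
    exact (sform_comm _ _).trans (h i)
  rw [sform_comm]
  exact h2 hw

theorem span_range_le_orthogonal {k : ℕ} (s : IsotropicTuple n k) :
    Submodule.span (ZMod 2) (Set.range s.1) ≤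
      (sympl n).orthogonal (Submodule.span (ZMod 2) (Set.range s.1)) := by
  rw [Submodule.span_le]
  rintro _ ⟨i, rfl⟩
  exact mem_orthogonal_span_range.2 fun j => s.2.2 j i

/-- An isotropic tuple is extended by a string orthogonal to, but not in, its span. -/
def isotropicTupleEquiv (n k : ℕ) : IsotropicTuple n (k + 1) ≃
    Σ s : IsotropicTuple n k,
      (((sympl n).orthogonal (Submodule.span (ZMod 2) (Set.range s.1)) : Set (PauliVec n)) \
        (Submodule.span (ZMod 2) (Set.range s.1) : Set (PauliVec n)) : Set (PauliVec n)) where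
  toFun s := ⟨⟨Fin.tail s.1, (linearIndependent_finSucc.1 s.2.1).1, fun i j => s.2.2 _ _⟩,
    s.1 0, mem_orthogonal_span_range.2 fun i => s.2.2 _ _, (linearIndependent_finSucc.1 s.2.1).2⟩
  invFun s := ⟨Fin.cons s.2.1 s.1.1, linearIndependent_finCons.2 ⟨s.1.2.1, s.2.2.2⟩, by
    have h := mem_orthogonal_span_range.1 s.2.2.1
    intro i j
    refine Fin.cases ?_ (fun i => ?_) i <;> refine Fin.cases ?_ (fun j => ?_) j
    · exact sform_self _
    · simpa using (sform_comm _ _).trans (h j)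
    · simpa using h i
    · simpa using s.1.2.2 i j⟩
  left_inv s := by simp only [Fin.cons_self_tail, Subtype.coe_eta]
  right_inv _ := rfl

/-- If `S` is the span of a tuple of length `k`, the next string ranges over `S^⊥ \ S`, where the
dimensions are `2 * n - k` and `k`. -/
theorem card_isotropicTuple (n k : ℕ) :
    Nat.card (IsotropicTuple n k) = ∏ i ∈ Finset.range k, (2 ^ (2 * n - i) - 2 ^ i) := by
  classical
  induction k with
  | zero =>
    rw [Finset.range_zero, Finset.prod_empty, Nat.card_eq_one_iff_unique]
    exact ⟨⟨fun a b => Subtype.ext (Subsingleton.elim _ _)⟩,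
      ⟨⟨Fin.elim0, linearIndependent_empty_type, fun i => i.elim0⟩⟩⟩
  | succ k ih =>
    have : Fintype (IsotropicTuple n k) := Fintype.ofFinite _
    have h : ∀ s : IsotropicTuple n k, Nat.card
        (((sympl n).orthogonal (Submodule.span (ZMod 2) (Set.range s.1)) : Set (PauliVec n)) \
        (Submodule.span (ZMod 2) (Set.range s.1) : Set (PauliVec n)) : Set (PauliVec n)) =
          2 ^ (2 * n - k) - 2 ^ k := fun s => by
      rw [Nat.card_coe_set_eq, Set.ncard_sdiff (span_range_le_orthogonal s) (Set.toFinite _),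
        ← Nat.card_coe_set_eq, ← Nat.card_coe_set_eq]
      refine congrArg₂ _ ((natCard_submodule _).trans ?_) ((natCard_submodule _).trans ?_)
      · rw [finrank_sympl_orthogonal, finrank_span_eq_card s.2.1, Fintype.card_fin]
      · rw [finrank_span_eq_card s.2.1, Fintype.card_fin]
    rw [Nat.card_congr (isotropicTupleEquiv n k), Nat.card_sigma, Finset.sum_congr rfl fun s _ => h s,
      Finset.sum_const, Finset.card_univ, smul_eq_mul, ← Nat.card_eq_fintype_card, ih,
      Finset.prod_range_succ]

theorem IsLagrangian.span_range {L : Submodule (ZMod 2) (PauliVec n)} (hL : IsLagrangian L)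
    {s : Fin n → L} (hs : LinearIndependent (ZMod 2) s) :
    Submodule.span (ZMod 2) (Set.range fun i => (s i : PauliVec n)) = L := by
  have h : LinearIndependent (ZMod 2) fun i => (s i : PauliVec n) :=
    hs.map' L.subtype L.ker_subtype
  refine Submodule.eq_of_le_of_finrank_eq ?_ ?_
  · rw [Submodule.span_le]
    rintro _ ⟨i, rfl⟩
    exact (s i).2
  · rw [finrank_span_eq_card h, Fintype.card_fin, hL.finrank_eq]

/-- A maximal isotropic tuple is the same as its Lagrangian span together with an ordered basis of
it. -/
theorem card_isotropicTuple_eq_mul (n : ℕ) :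
    Nat.card (IsotropicTuple n n) =
      Nat.card {L : Submodule (ZMod 2) (PauliVec n) // IsLagrangian L} *
        ∏ i ∈ Finset.range n, (2 ^ n - 2 ^ i) := by
  classical
  have : Fintype {L : Submodule (ZMod 2) (PauliVec n) // IsLagrangian L} := Fintype.ofFinite _
  have hf : Function.Bijective
      (fun x : Σ L : {L : Submodule (ZMod 2) (PauliVec n) // IsLagrangian L},
          {s : Fin n → L.1 // LinearIndependent (ZMod 2) s} =>
        (⟨fun i => (x.2.1 i : PauliVec n), x.2.2.map' x.1.1.subtype x.1.1.ker_subtype,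
          fun i j => x.1.2.sform_eq_zero (x.2.1 i).2 (x.2.1 j).2⟩ : IsotropicTuple n n)) := by
    constructor
    · rintro ⟨⟨L, hL⟩, ⟨s, hs⟩⟩ ⟨⟨M, hM⟩, ⟨t, ht⟩⟩ h
      have h1 : (fun i => (s i : PauliVec n)) = fun i => (t i : PauliVec n) :=
        congrArg Subtype.val h
      have h2 : L = M := by
        rw [← hL.span_range hs, h1, hM.span_range ht]
      subst h2
      have h3 : s = t := funext fun i => Subtype.ext (congrFun h1 i)
      subst h3
      rfl
    · intro s
      refine ⟨⟨⟨Submodule.span (ZMod 2) (Set.range s.1), isLagrangian_of_finrank ?_ ?_⟩,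
        fun i => ⟨s.1 i, Submodule.subset_span ⟨i, rfl⟩⟩, ?_⟩, rfl⟩
      · intro v hv w hw
        exact mem_sympl_orthogonal.1 (span_range_le_orthogonal s hw) v hv
      · rw [finrank_span_eq_card s.2.1, Fintype.card_fin]
      · exact LinearIndependent.of_comp (Submodule.subtype _) s.2.1
  rw [← Nat.card_congr (Equiv.ofBijective _ hf), Nat.card_sigma]
  have h : ∀ L : {L : Submodule (ZMod 2) (PauliVec n) // IsLagrangian L},
      Nat.card {s : Fin n → L.1 // LinearIndependent (ZMod 2) s} =
        ∏ i ∈ Finset.range n, (2 ^ n - 2 ^ i) := fun L => by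
    rw [card_linearIndependent L.2.finrank_eq.ge, L.2.finrank_eq, ZMod.card,
      Finset.prod_range]
  rw [Finset.sum_congr rfl fun L _ => h L, Finset.sum_const, Finset.card_univ, smul_eq_mul,
    ← Nat.card_eq_fintype_card]

/-- The two counts of maximal tuples are divided factor by factor: the quotient at index `i` is `2 ^
(n - i) + 1`. -/
theorem card_isLagrangian (n : ℕ) :
    Nat.card {L : Submodule (ZMod 2) (PauliVec n) // IsLagrangian L} =
      ∏ j ∈ Finset.Icc 1 n, (2 ^ j + 1) := by
  have h1 := card_isotropicTuple_eq_mul n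
  have h2 : ∀ i ∈ Finset.range n, 2 ^ (2 * n - i) - 2 ^ i = (2 ^ (n - i) + 1) * (2 ^ n - 2 ^ i) := by
    intro i hi
    have hi := Finset.mem_range.1 hi
    obtain ⟨m, rfl⟩ := Nat.exists_eq_add_of_le hi.le
    rw [show 2 * (i + m) - i = i + m + m by omega, show i + m - i = m by omega, Nat.mul_sub,
      add_mul, add_mul, one_mul, one_mul, pow_add 2 (i + m) m, pow_add 2 i m, mul_comm (2 ^ m) (2 ^ i),
      mul_comm (2 ^ m) (2 ^ i * 2 ^ m)]
    omega
  rw [card_isotropicTuple, Finset.prod_congr rfl h2, Finset.prod_mul_distrib] at h1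
  have h0 : 0 < ∏ i ∈ Finset.range n, (2 ^ n - 2 ^ i) := Finset.prod_pos fun i hi =>
    Nat.sub_pos_of_lt (Nat.pow_lt_pow_right one_lt_two (Finset.mem_range.1 hi))
  rw [← Nat.eq_of_mul_eq_mul_right h0 h1]
  refine Finset.prod_nbij' (fun i => n - i) (fun j => n - j) ?_ ?_ ?_ ?_ fun _ _ => rfl <;>
    · intro i hi
      simp only [Finset.mem_range, Finset.mem_Icc] at *
      omega

/-- The number of pure stabilizer states. -/
theorem encard_stabStates (n : ℕ) : (stabStates n).encard = (stabCount n : ℕ∞) := by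
  classical
  have : Fintype {L : Submodule (ZMod 2) (PauliVec n) // IsLagrangian L} := Fintype.ofFinite _
  have hfin : ∀ L : {L : Submodule (ZMod 2) (PauliVec n) // IsLagrangian L},
      Finite {ρ : Op n // IsPure ρ ∧ StabBy L.1 ρ} := fun L =>
    Nat.finite_of_card_ne_zero (by rw [L.2.card_states]; positivity)
  have hf : Function.Bijective
      (fun x : Σ L : {L : Submodule (ZMod 2) (PauliVec n) // IsLagrangian L},
          {ρ : Op n // IsPure ρ ∧ StabBy L.1 ρ} =>
        (⟨x.2.1, mem_stabStates_iff.2 ⟨x.2.2.1, _, x.2.2.2⟩⟩ : stabStates n)) := by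
    constructor
    · rintro ⟨⟨L, hL⟩, ⟨ρ, hρ⟩⟩ ⟨⟨M, hM⟩, ⟨σ, hσ⟩⟩ h
      obtain rfl : ρ = σ := congrArg Subtype.val h
      obtain rfl := hρ.2.unique hσ.2
      rfl
    · rintro ⟨ρ, hρ⟩
      obtain ⟨hp, L, hL⟩ := mem_stabStates_iff.1 hρ
      exact ⟨⟨⟨L, hL.lag⟩, ⟨ρ, hp, hL⟩⟩, rfl⟩
  have : Finite (stabStates n) := Finite.of_surjective _ hf.2
  rw [← Set.Finite.cast_ncard_eq (Set.toFinite _), ← Nat.card_coe_set_eq,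
    ← Nat.card_congr (Equiv.ofBijective _ hf), Nat.card_sigma,
    Finset.sum_congr rfl fun L _ => L.2.card_states, Finset.sum_const, Finset.card_univ,
    smul_eq_mul, ← Nat.card_eq_fintype_card, card_isLagrangian, stabCount, mul_comm]

/-! ### Preparing stabilizer states -/

theorem list_prod_mul_of_fixed {τ : Op n} {l : List (Op n)} (h : ∀ A ∈ l, A * τ = τ) :
    l.prod * τ = τ := by
  induction l with
  | nil => simp
  | cons A l ih =>
    rw [List.prod_cons, mul_assoc, ih fun B hB => h B (List.mem_cons_of_mem A hB),
      h A List.mem_cons_self]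

theorem list_prod_mul_eq_zero {τ : Op n} {l : List (Op n)} (h : ∀ A ∈ l, A * τ = τ ∨ A * τ = 0)
    (h0 : ∃ A ∈ l, A * τ = 0) : l.prod * τ = 0 := by
  induction l with
  | nil => simp at h0
  | cons A l ih =>
    rw [List.prod_cons, mul_assoc]
    by_cases hl : ∃ B ∈ l, B * τ = 0
    · rw [ih (fun B hB => h B (List.mem_cons_of_mem A hB)) hl, mul_zero]
    · push Not at hl
      rw [list_prod_mul_of_fixed fun B hB =>
        (h B (List.mem_cons_of_mem A hB)).resolve_right (hl B hB)]
      obtain ⟨B, hB, hB0⟩ := h0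
      rcases List.mem_cons.1 hB with rfl | hB
      · exact hB0
      · exact absurd hB0 (hl B hB)

theorem strProj_mul_of_units {v : PauliVec n} (k : ℤˣ) {l : ℤˣ} {τ : Op n}
    (h : strOp v * τ = unitSign l • τ) :
    strProj v k * τ = τ ∨ strProj v k * τ = 0 := by
  by_cases hkl : l = k
  · subst hkl; exact Or.inl (strProj_mul_of_sign h)
  · rw [units_eq_neg_of_ne hkl] at h; exact Or.inr (strProj_mul_of_sign_neg h)

/-- Measuring the whole stabilizer of a pure state projects on this state. -/
theorem StabBy.exists_event {L : Submodule (ZMod 2) (PauliVec n)} {ρ : Op n} (h : StabBy L ρ)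
    (hρ : IsPure ρ) : ∃ E : Event n, E.proj = ρ ∧ ρ * ρ = ρ := by
  classical
  choose κ hκ using fun v : L => h.sign v v.2
  obtain ⟨N, ⟨e⟩⟩ := Finite.exists_equiv_fin L
  let E : Event n :=
    { meas :=
        { len := N
          obs := fun i => strObs (e.symm i : PauliVec n)
          comm := fun i j => strOp_commute (h.lag.sform_eq_zero (e.symm i).2 (e.symm j).2) }
      outcome := fun i => κ (e.symm i) }
  have hmem : ∀ A, A ∈ (List.ofFn fun i => (E.meas.obs i).proj (E.outcome i)) ↔
      ∃ v : L, strProj (v : PauliVec n) (κ v) = A := fun A => by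
    rw [List.mem_ofFn]
    exact e.symm.surjective.exists (p := fun v : L => strProj (v : PauliVec n) (κ v) = A) |>.symm
  have h1 : E.proj * ρ = ρ := list_prod_mul_of_fixed fun A hA => by
    obtain ⟨v, rfl⟩ := (hmem A).1 hA
    exact strProj_mul_of_sign (hκ v)
  -- Conjugating by `u ∈ L` returns `ρ` itself; for other `u` some sign is reversed, and the
  -- corresponding factor of `E.proj` kills the conjugate.
  have h2 : ∀ u, E.proj * (strOp u * ρ * strOp u) = if u ∈ L then ρ else 0 := fun u => by
    split_ifs with hu
    · have : StabSim.strConj ρ u = StabSim.strConj ρ 0 := (h.strConj_eq_iff hρ u 0).2 (by simpa using hu)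
      simp only [StabSim.strConj, strOp_zero, one_mul, mul_one] at this
      rw [this, h1]
    · refine list_prod_mul_eq_zero (fun A hA => ?_) ?_
      · obtain ⟨v, rfl⟩ := (hmem A).1 hA
        obtain ⟨l, hl⟩ := (h.strConj hρ u).sign v v.2
        exact strProj_mul_of_units _ hl
      · obtain ⟨w, hw, huw⟩ : ∃ w ∈ L, sform u w = 1 := by
          by_contra! hc
          exact hu ((h.lag u).2 fun w hw => (zmod_two_cases _).resolve_right (hc w hw))
        refine ⟨_, (hmem _).2 ⟨⟨w, hw⟩, rfl⟩, strProj_mul_of_sign_neg ?_⟩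
        have := strOp_mul_strConj (hκ ⟨w, hw⟩) u
        rwa [sform_comm, huw, bitSign_one, neg_one_mul, ← unitSign_neg] at this
  have h3 : E.proj = ρ := by
    -- Only the `2 ^ n` terms with `u ∈ L` survive, while the whole sum is `2 ^ n` times the
    -- identity.
    have h4 : E.proj * ∑ u : PauliVec n, strOp u * ρ * strOp u = (2 ^ n : ℂ) • ρ := by
      rw [Finset.mul_sum, Finset.sum_congr rfl fun u _ => h2 u, ← Finset.sum_filter,
        Finset.sum_const, ← Nat.cast_smul_eq_nsmul ℂ]
      have := h.lag.natCard_eq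
      rw [Nat.card_eq_fintype_card, Fintype.card_subtype] at this
      rw [this]
      push_cast
      rfl
    rw [sum_strOp_conj, h.trace_one, mul_one, mul_smul_comm, mul_one] at h4
    exact smul_right_injective _ (pow_ne_zero n (two_ne_zero (α := ℂ))) h4
  exact ⟨E, h3, by rw [h3] at h1; exact h1⟩

/-- A single event suffices: its projector is `ρ`, and projecting the maximally mixed state on `ρ`
gives `ρ`. -/
theorem exists_record {ρ : Op n} (hρ : ρ ∈ stabStates n) :
    ∃ R : {R : Record n // Possible R}, recordState R.1 = ρ := by
  obtain ⟨hp, L, hL⟩ := mem_stabStates_iff.1 hρ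
  obtain ⟨E, hE, hρρ⟩ := hL.exists_event hp
  have h2 : (1 / 2 ^ n : ℂ) ≠ 0 := one_div_ne_zero (pow_ne_zero n two_ne_zero)
  refine ⟨⟨[E], trivial, ?_⟩, ?_⟩
  · rw [recordState, born, hE, mul_smul_comm, mul_one, Matrix.trace_smul, hL.trace_one]
    simp
  · rw [recordState, recordState, post, hE, mul_smul_comm, mul_one, smul_mul_assoc, hρρ,
      Matrix.trace_smul, hL.trace_one, smul_smul, smul_eq_mul, mul_one, inv_mul_cancel₀ h2,
      one_smul]

/-! ### Counting internal states -/

namespace Simulation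

variable {Λ : Type*} (S : Simulation n Λ)

theorem supp_nonempty {ρ : Op n} (hρ : ρ ∈ stabStates n) : (S.supp ρ).Nonempty := by
  obtain ⟨R, hR⟩ := exists_record hρ
  obtain ⟨l, hl⟩ := (S.μ R).support_nonempty
  exact ⟨l, R, hR, hl⟩

/-- Pigeonhole: pick an internal state in the support of each pure state; the states sent to the
same `l` obey the bound for a common internal state. -/
theorem stabCount_le_mul_card [Finite Λ] (hn : 2 ≤ n) (hU : S.StateUpdate) (hS : S.SSD) :
    stabCount n ≤ 5 * 3 ^ (n - 2) * Nat.card Λ := by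
  classical
  have : Fintype Λ := Fintype.ofFinite Λ
  have hfin : (stabStates n).Finite :=
    Set.finite_of_encard_eq_coe (encard_stabStates n)
  have : Nonempty Λ := (S.μ ⟨[], trivial⟩).support_nonempty.to_type
  choose! f hf using fun ρ (hρ : ρ ∈ stabStates n) => S.supp_nonempty hρ
  have hc : hfin.toFinset.card = stabCount n := by
    have := encard_stabStates n
    rw [hfin.encard_eq_coe_toFinset_card] at this
    exact_mod_cast this
  rw [← hc, Nat.card_eq_fintype_card, ← Finset.card_univ]
  refine Finset.card_le_mul_card_image_of_maps_to (f := f) (fun _ _ => Finset.mem_univ _) _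
    fun l _ => ?_
  have h := S.encard_le_of_mem_supp hU hS (n - 2) l
    ((hfin.toFinset.filter fun ρ => f ρ = l : Finset (Op n)) : Set (Op n)) ⊥ ?_ ?_
    (fun _ _ _ _ => bot_le) (by rw [finrank_bot]; omega)
  · rw [Set.encard_coe_eq_coe_finsetCard] at h
    exact_mod_cast h
  · intro ρ hρ
    simp only [Finset.coe_filter, Set.Finite.mem_toFinset, Set.mem_ofPred_eq] at hρ
    exact hρ.1
  · intro ρ hρ
    simp only [Finset.coe_filter, Set.Finite.mem_toFinset, Set.mem_ofPred_eq] at hρ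
    exact hρ.2 ▸ hf ρ hρ.1

theorem stabCount_le_mul_encard (hn : 2 ≤ n) (hU : S.StateUpdate) (hS : S.SSD) :
    (stabCount n : ℕ∞) ≤ ((5 * 3 ^ (n - 2) : ℕ) : ℕ∞) * ENat.card Λ := by
  rcases finite_or_infinite Λ with h | h
  · rw [ENat.card_eq_coe_natCard]
    exact_mod_cast S.stabCount_le_mul_card hn hU hS
  · rw [ENat.card_eq_top_of_infinite, ENat.mul_top (by positivity)]
    exact le_top

end Simulation

/-! ### Asymptotics -/

theorem stabCount_succ (n : ℕ) : stabCount (n + 1) = stabCount n * (2 * (2 ^ (n + 1) + 1)) := by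
  rw [stabCount, stabCount, Finset.prod_Icc_succ_top (by omega), pow_succ]
  ring

theorem stabCount_pos (n : ℕ) : 0 < stabCount n := by
  rw [stabCount]; exact Nat.mul_pos (by positivity) (Finset.prod_pos fun _ _ => by positivity)

/-- From `n` to `n + 1` the left side grows by `3 * 2 ^ n`, the right side by `4 * 2 ^ n + 2`. -/
theorem two_pow_choose_mul_le (hn : 2 ≤ n) :
    2 ^ n.choose 2 * (5 * 3 ^ (n - 2)) ≤ stabCount n := by
  induction n, hn using Nat.le_induction with
  | base => decide
  | succ n hn ih =>
    rw [stabCount_succ, Nat.choose_succ_succ' n 1, Nat.choose_one_right,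
      show n + 1 - 2 = n - 2 + 1 by omega, pow_add, pow_succ 3]
    calc 2 ^ n * 2 ^ n.choose 2 * (5 * (3 ^ (n - 2) * 3))
        = 2 ^ n.choose 2 * (5 * 3 ^ (n - 2)) * (2 ^ n * 3) := by ring
      _ ≤ stabCount n * (2 * (2 ^ (n + 1) + 1)) := Nat.mul_le_mul ih (by rw [pow_succ]; omega)

theorem stabCount_le (n : ℕ) : stabCount n ≤ 2 ^ (n.choose 2 + 3 * n) := by
  induction n with
  | zero => decide
  | succ n ih =>
    rw [stabCount_succ, Nat.choose_succ_succ' n 1, Nat.choose_one_right,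
      show n + n.choose 2 + 3 * (n + 1) = n.choose 2 + 3 * n + (n + 3) by ring,
      pow_add 2 (n.choose 2 + 3 * n)]
    refine Nat.mul_le_mul ih ?_
    have := Nat.one_le_two_pow (n := n)
    rw [pow_succ 2 n, pow_add 2 n 3]
    omega

theorem choose_two_le_logb (hn : 2 ≤ n) :
    (n : ℝ) * (n - 1) / 2 ≤ Real.logb 2 ((stabCount n : ℝ) / (5 * 3 ^ (n - 2))) := by
  have h0 : (0 : ℝ) < stabCount n := by exact_mod_cast stabCount_pos n
  rw [← Nat.cast_choose_two, Real.le_logb_iff_rpow_le one_lt_two (by positivity),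
    Real.rpow_natCast, le_div_iff₀ (by positivity)]
  exact_mod_cast two_pow_choose_mul_le hn

theorem logb_le_choose_two (n : ℕ) :
    Real.logb 2 ((stabCount n : ℝ) / (5 * 3 ^ (n - 2))) ≤ (n : ℝ) * (n - 1) / 2 + 3 * n := by
  have h0 : (0 : ℝ) < stabCount n := by exact_mod_cast stabCount_pos n
  rw [← Nat.cast_choose_two, Real.logb_le_iff_le_rpow one_lt_two (by positivity),
    div_le_iff₀ (by positivity), show ((n.choose 2 : ℕ) : ℝ) + 3 * n = ((n.choose 2 + 3 * n : ℕ) : ℝ) by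
      push_cast; rfl, Real.rpow_natCast]
  have h1 : (stabCount n : ℝ) ≤ 2 ^ (n.choose 2 + 3 * n) := by exact_mod_cast stabCount_le n
  have h2 : (1 : ℝ) ≤ 5 * 3 ^ (n - 2) := by
    have : (1 : ℝ) ≤ 3 ^ (n - 2) := one_le_pow₀ (by norm_num)
    linarith
  exact h1.trans (le_mul_of_one_le_right (by positivity) h2)

/-- The difference of the two sequences lies between `0` and `3 * n` for `n ≥ 2`, which is
negligible against a quadratic. -/
theorem logb_stabCount_isEquivalent : Asymptotics.IsEquivalent Filter.atTop
    (fun n : ℕ => Real.logb 2 ((stabCount n : ℝ) / (5 * 3 ^ (n - 2))))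
    (fun n : ℕ => (n : ℝ) * (n - 1) / 2) := by
  have h1 : (fun n : ℕ => Real.logb 2 ((stabCount n : ℝ) / (5 * 3 ^ (n - 2))) -
      (n : ℝ) * (n - 1) / 2) =O[Filter.atTop] fun n : ℕ => (n : ℝ) := by
    refine Asymptotics.IsBigO.of_bound 3 ?_
    filter_upwards [Filter.eventually_ge_atTop 2] with n hn
    have := choose_two_le_logb hn
    have := logb_le_choose_two n
    rw [Real.norm_of_nonneg (by linarith), Real.norm_natCast]
    linarith
  refine h1.trans_isLittleO (Asymptotics.isLittleO_iff.2 fun c hc => ?_)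
  -- The threshold makes `c * (n - 1) / 2 ≥ 1`, which is the required inequality divided by `n`.
  filter_upwards [Filter.eventually_ge_atTop (⌈2 / c⌉₊ + 1)] with n hn
  have h2 : 2 / c ≤ (n : ℝ) - 1 := by
    have h3 : (((⌈2 / c⌉₊ + 1 : ℕ) : ℕ) : ℝ) ≤ n := by exact_mod_cast hn
    push_cast at h3
    linarith [Nat.le_ceil (2 / c)]
  have h4 : 2 ≤ c * ((n : ℝ) - 1) := by rwa [div_le_iff₀' hc] at h2
  have h5 : (0 : ℝ) ≤ n - 1 := (by positivity : (0 : ℝ) ≤ 2 / c).trans h2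
  rw [Real.norm_natCast, Real.norm_of_nonneg (by positivity)]
  nlinarith [(Nat.cast_nonneg n : (0 : ℝ) ≤ n)]

theorem Simulation.logb_le {Λ : Type*} (S : Simulation n Λ) (hn : 2 ≤ n) (hU : S.StateUpdate)
    (hS : S.SSD) {b : ℕ} {f : Λ → (Fin b → Bool)} (hf : Function.Injective f) :
    Real.logb 2 ((stabCount n : ℝ) / (5 * 3 ^ (n - 2))) ≤ b := by
  have : Finite Λ := Finite.of_injective f hf
  have h1 : Nat.card Λ ≤ 2 ^ b := by
    simpa using Nat.card_le_card_of_injective f hf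
  have h2 : (stabCount n : ℝ) ≤ 2 ^ b * (5 * 3 ^ (n - 2)) := by
    have := (S.stabCount_le_mul_card hn hU hS).trans (Nat.mul_le_mul_left _ h1)
    rw [mul_comm] at this
    exact_mod_cast this
  have h0 : (0 : ℝ) < stabCount n := by exact_mod_cast stabCount_pos n
  rw [Real.logb_le_iff_le_rpow one_lt_two (by positivity), Real.rpow_natCast,
    div_le_iff₀ (by positivity)]
  exact h2

end

end StabSim

theorem theorem3 :
    -- common supports are empty
    (∀ (n : ℕ) (Λ : Type*) (S : StabSim.Simulation n Λ), 2 ≤ n → S.StateUpdate → S.SSD →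
      ∀ s : Set (StabSim.Op n), s ⊆ StabSim.stabStates n →
        ((5 * 3 ^ (n - 2) : ℕ) : ℕ∞) < s.encard → ⋂ ρ ∈ s, S.supp ρ = ∅) ∧
    -- two qubits: partitioning measurements exist
    (∀ s : Set (StabSim.Op 2), s ⊆ StabSim.stabStates 2 → 6 ≤ s.encard →
      ∃ O : StabSim.PauliObs 2, O.op ≠ 1 ∧ O.op ≠ -1 ∧ StabSim.IsPartitioning O s) ∧
    -- the number of pure stabilizer states
    (∀ n : ℕ, (StabSim.stabStates n).encard = (StabSim.stabCount n : ℕ∞)) ∧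
    -- the number of internal states, and of bits
    (∀ (n : ℕ) (Λ : Type*) (S : StabSim.Simulation n Λ), 2 ≤ n → S.StateUpdate → S.SSD →
      (StabSim.stabCount n : ℕ∞) ≤ ((5 * 3 ^ (n - 2) : ℕ) : ℕ∞) * ENat.card Λ ∧
      ∀ (b : ℕ) (f : Λ → (Fin b → Bool)), Function.Injective f →
        Real.logb 2 ((StabSim.stabCount n : ℝ) / (5 * 3 ^ (n - 2))) ≤ b ∧
        (n : ℝ) * (n - 1) / 2 ≤ b) ∧
    Asymptotics.IsEquivalent Filter.atTop
      (fun n : ℕ => Real.logb 2 ((StabSim.stabCount n : ℝ) / (5 * 3 ^ (n - 2))))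
      (fun n : ℕ => (n : ℝ) * (n - 1) / 2) := by
  refine ⟨fun n Λ S hn hU hS s hs hc => S.iInter_supp_eq_empty hn hU hS hs hc,
    fun s hs h6 => StabSim.exists_isPartitioning hs h6, StabSim.encard_stabStates,
    fun n Λ S hn hU hS => ⟨S.stabCount_le_mul_encard hn hU hS, fun b f hf => ?_⟩,
    StabSim.logb_stabCount_isEquivalent⟩
  have h := S.logb_le hn hU hS hf
  exact ⟨h, (StabSim.choose_two_le_logb hn).trans h⟩
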